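/- Let $k$ be a field and let $\mathcal{A}$ be a skeletally small $k$-linear abelian category that is Hom-finite, i.e. all Hom spaces are finite dimensional over $k$. Write $D$ for the $k$-linear dual. A Serre duality on such a category is a $k$-linear auto-equivalence $\mathbb{S}$ (the Serre functor) together with $k$-linear isomorphisms $D\,\mathrm{Ext}^1(X,Y)\cong \mathrm{Hom}(Y,\mathbb{S}X)$ natural in $X$ and $Y$; it is periodic if $\mathbb{S}^d$ is naturally isomorphic to the identity functor for some $d\ge 1$. Let $G$ be a finite group with a $k$-linear action on $\mathcal{A}$: $k$-linear auto-equivalences $F_g$ of $\mathcal{A}$ $(g\in G)$ and natural isomorphisms $\varepsilon_{g,h}\colon F_gF_h\to F_{gh}$ with $\varepsilon_{gh,l}\circ\varepsilon_{g,h}F_l=\varepsilon_{g,hl}\circ F_g\varepsilon_{h,l}$ for all $g,h,l\in G$. Let $\mathcal{A}^G$ be the ($k$-linear, abelian, Hom-finite) category of $G$-equivariant objects: pairs $(X,\alpha)$ with isomorphisms $\alpha_g\colon X\to F_gX$ $(g \in G)$ satisfying $\alpha_{gh}=(\varepsilon_{g,h})_X\circ F_g(\alpha_h)\circ\alpha_g$,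 where a morphism $(X,\alpha)\to(Y,\beta)$ is a morphism $f\colon X\to Y$ with $\beta_g\circ f=F_g(f)\circ\alpha_g$ for all $g\in G$. Let $Z(\mathcal{A})$ be the center of $\mathcal{A}$, i.e. the ring of natural transformations $\mathrm{Id}_{\mathcal{A}}\to\mathrm{Id}_{\mathcal{A}}$, which acts on all Hom spaces of $\mathcal{A}$. Suppose that $\mathcal{A}$ has a periodic Serre duality, that every $F_g$ is $Z(\mathcal{A})$-linear (equivalently, $F_g(\lambda_X)=\lambda_{F_gX}$ for all $\lambda\in Z(\mathcal{A})$ and all objects $X$), and that $|G|$ is invertible in $k$. Then $\mathcal{A}^G$ has a periodic Serre duality. -/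

import Mathlib

open CategoryTheory CategoryTheory.Limits

universe w v u t s

namespace Equivariantization

/-! ### Serre duality on a Hom-finite linear abelian category -/

section Serre

variable (k : Type t) [Field k] (A : Type u) [Category.{v} A] [Abelian A] [Linear k A]

/-- All Hom spaces are finite dimensional over `k`. -/
class HomFinite : Prop where
  finite (X Y : A) : Module.Finite k (X ⟶ Y)

/-- A Serre duality: a `k`-linear auto-equivalence `S` (the Serre functor) together with
`k`-linear isomorphisms `D Ext¹(X, Y) ≃ Hom(Y, S X)` that are natural in `X` and in `Y`, where
`D` is the `k`-linear dual. -/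
structure SerreDuality [HomFinite k A] [HasExt.{w} A] where
  /-- The Serre functor. -/
  S : A ⥤ A
  isEquivalence : S.IsEquivalence
  additive : S.Additive
  linear : S.Linear k
  /-- The isomorphisms `D Ext¹(X, Y) ≃ Hom(Y, S X)`. -/
  φ (X Y : A) : Module.Dual k (Abelian.Ext X Y 1) ≃ₗ[k] (Y ⟶ S.obj X)
  /-- Naturality in the first variable: a morphism `f : X ⟶ X'` acts on the left-hand side by
  `l ↦ (ξ' ↦ l (ξ'.f))`, where `ξ'.f` is the pullback of `ξ'` along `f`. -/
  naturality_left {X X' : A} (f : X ⟶ X') (Y : A) (l : Module.Dual k (Abelian.Ext X Y 1)) :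
    φ X' Y (l ∘ₗ (Abelian.Ext.mk₀ f).precompOfLinear k Y (zero_add 1)) = φ X Y l ≫ S.map f
  /-- Naturality in the second variable: a morphism `g : Y ⟶ Y'` acts on the left-hand side by
  `l ↦ (ξ ↦ l (g.ξ))`, where `g.ξ` is the pushout of `ξ` along `g`. -/
  naturality_right (X : A) {Y Y' : A} (g : Y ⟶ Y') (l : Module.Dual k (Abelian.Ext X Y' 1)) :
    φ X Y (l ∘ₗ (Abelian.Ext.mk₀ g).postcompOfLinear k X (add_zero 1)) = g ≫ φ X Y' l

variable {A} in
/-- The `d`-th power of an endofunctor. -/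
def functorPow (F : A ⥤ A) : ℕ → (A ⥤ A)
  | 0 => 𝟭 A
  | d + 1 => functorPow F d ⋙ F

variable {A} in
/-- An endofunctor `F` is periodic if `F ^ d` is isomorphic to the identity for some `d ≥ 1`. -/
def IsPeriodic (F : A ⥤ A) : Prop :=
  ∃ d : ℕ, 1 ≤ d ∧ Nonempty (functorPow F d ≅ 𝟭 A)

/-- `A` has a periodic Serre duality: it has a Serre duality whose Serre functor is periodic. -/
def HasPeriodicSerreDuality [HomFinite k A] : Prop :=
  letI : HasExt.{max u v} A := HasExt.standard A
  ∃ D : SerreDuality.{max u v} k A, IsPeriodic D.S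

end Serre

/-- An endofunctor is compatible with the action of the center `Z(A)` (the natural endomorphisms
of the identity functor) on Hom spaces. For an additive functor, this is `Z(A)`-linearity. -/
def IsCenterLinear {A : Type u} [Category.{v} A] (F : A ⥤ A) : Prop :=
  ∀ ⦃X Y : A⦄ (z : CatCenter A) (f : X ⟶ Y), F.map (z • f) = z • F.map f

/-! ### Linear group actions and equivariant objects -/

/-- A `k`-linear action of the group `G` on `A`: `k`-linear auto-equivalences `F g` and
isomorphisms `F g ∘ F h ≅ F (g * h)` satisfying the 2-cocycle condition. (In Mathlib, `F h ⋙ F g`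
is `F g ∘ F h`; the `eqToHom` is the identification of `F (g * h * l)` with `F (g * (h * l))`.) -/
structure LinearAction (k : Type t) [Field k] (G : Type s) [Group G]
    (A : Type u) [Category.{v} A] [Abelian A] [Linear k A] where
  F : G → (A ⥤ A)
  isEquivalence (g : G) : (F g).IsEquivalence
  additive (g : G) : (F g).Additive
  linear (g : G) : (F g).Linear k
  ε (g h : G) : F h ⋙ F g ≅ F (g * h)
  cocycle (g h l : G) (X : A) :
    (ε g h).hom.app ((F l).obj X) ≫ (ε (g * h) l).hom.app X ≫
        eqToHom (congrArg (fun x => (F x).obj X) (mul_assoc g h l)) =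
      (F g).map ((ε h l).hom.app X) ≫ (ε g (h * l)).hom.app X

attribute [instance] LinearAction.isEquivalence LinearAction.additive LinearAction.linear

lemma lift_aux {C : Type u} [Category.{v} C] (F : C ⥤ C) {S P Q : C} (l : S ⟶ P) (p : P ⟶ Q) (q : S ⟶ Q)
    (hl : l ≫ p = q)
    {β : P ⟶ F.obj P} {γ : Q ⟶ F.obj Q} {σ : S ⟶ F.obj S}
    (hp : β ≫ F.map p = p ≫ γ) (hq : q ≫ γ = σ ≫ F.map q) :
    (l ≫ β) ≫ F.map p = (σ ≫ F.map l) ≫ F.map p := by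
  rw [Category.assoc, Category.assoc, hp, ← Functor.map_comp, hl, ← hq, ← hl, Category.assoc]

lemma desc_aux {C : Type u} [Category.{v} C] (F : C ⥤ C) {S P Q : C} (l : P ⟶ S) (p : Q ⟶ P) (q : Q ⟶ S)
    (hl : p ≫ l = q)
    {β : P ⟶ F.obj P} {γ : Q ⟶ F.obj Q} {σ : S ⟶ F.obj S}
    (hp : p ≫ β = γ ≫ F.map p) (hq : q ≫ σ = γ ≫ F.map q) :
    p ≫ l ≫ σ = p ≫ β ≫ F.map l := by
  rw [← Category.assoc, hl, hq, ← Category.assoc p, hp, Category.assoc, ← Functor.map_comp, hl]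

section Equivariant

variable {k : Type t} [Field k] {G : Type s} [Group G]
  {A : Type u} [Category.{v} A] [Abelian A] [Linear k A]

/-- An equivariant object `(X, α)`. -/
structure EquivariantObject (a : LinearAction k G A) where
  X : A
  α (g : G) : X ≅ (a.F g).obj X
  α_mul (g h : G) : (α (g * h)).hom = (α g).hom ≫ (a.F g).map (α h).hom ≫ (a.ε g h).hom.app X

variable {a : LinearAction k G A}

namespace EquivariantObject

/-- A morphism of equivariant objects. -/
@[ext]
structure Hom (M N : EquivariantObject a) where
  hom : M.X ⟶ N.X
  comm (g : G) : hom ≫ (N.α g).hom = (M.α g).hom ≫ (a.F g).map hom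

lemma Hom.comm_assoc {M N : EquivariantObject a} (f : Hom M N) (g : G) {Z : A}
    (h : (a.F g).obj N.X ⟶ Z) :
    f.hom ≫ (N.α g).hom ≫ h = (M.α g).hom ≫ (a.F g).map f.hom ≫ h := by
  rw [← Category.assoc, f.comm, Category.assoc]

instance : Category (EquivariantObject a) where
  Hom M N := Hom M N
  id M := ⟨𝟙 M.X, fun g => by simp⟩
  comp f g := ⟨f.hom ≫ g.hom, fun x => by
    rw [Category.assoc, g.comm, f.comm_assoc, Functor.map_comp]⟩

@[ext]
lemma hom_ext {M N : EquivariantObject a} {f g : M ⟶ N} (h : f.hom = g.hom) : f = g :=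
  Hom.ext h

@[simp] lemma id_hom (M : EquivariantObject a) : Hom.hom (𝟙 M) = 𝟙 M.X := rfl

@[simp] lemma comp_hom {M N P : EquivariantObject a} (f : M ⟶ N) (g : N ⟶ P) :
    (f ≫ g).hom = f.hom ≫ g.hom := rfl

variable {M N : EquivariantObject a}

instance : Add (M ⟶ N) := ⟨fun f g => ⟨f.hom + g.hom, fun x => by
  simp [f.comm, g.comm, Functor.map_add]⟩⟩
instance : Zero (M ⟶ N) := ⟨⟨0, fun x => by simp⟩⟩
instance : Neg (M ⟶ N) := ⟨fun f => ⟨-f.hom, fun x => by simp [f.comm, Functor.map_neg]⟩⟩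
instance : Sub (M ⟶ N) := ⟨fun f g => ⟨f.hom - g.hom, fun x => by
  simp [f.comm, g.comm, Functor.map_sub]⟩⟩
instance : SMul k (M ⟶ N) :=
  ⟨fun c f => ⟨c • f.hom, fun x => by simp [f.comm, Functor.map_smul]⟩⟩
instance : SMul ℕ (M ⟶ N) := ⟨fun n f => ⟨n • f.hom, fun x => by
  simp [f.comm]⟩⟩
instance : SMul ℤ (M ⟶ N) := ⟨fun n f => ⟨n • f.hom, fun x => by
  simp [f.comm]⟩⟩

lemma hom_injective : Function.Injective (fun f : M ⟶ N => f.hom) := fun _ _ h => hom_ext h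

instance : AddCommGroup (M ⟶ N) :=
  hom_injective.addCommGroup _ rfl (fun _ _ => rfl) (fun _ => rfl) (fun _ _ => rfl)
    (fun _ _ => rfl) (fun _ _ => rfl)

@[simp] lemma add_hom (f g : M ⟶ N) : (f + g).hom = f.hom + g.hom := rfl

instance : Preadditive (EquivariantObject a) where
  add_comp _ _ _ f f' g := by ext; simp
  comp_add _ _ _ f g g' := by ext; simp

/-- Taking the underlying morphism, as an additive map. -/
def homAddHom (M N : EquivariantObject a) : (M ⟶ N) →+ (M.X ⟶ N.X) where
  toFun f := f.hom
  map_zero' := rfl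
  map_add' _ _ := rfl

instance : Module k (M ⟶ N) :=
  hom_injective.module k (homAddHom M N) (fun _ _ => rfl)

@[simp] lemma smul_hom (c : k) (f : M ⟶ N) : (c • f).hom = c • f.hom := rfl

instance : Linear k (EquivariantObject a) where
  smul_comp _ _ _ c f g := by ext; simp
  comp_smul _ _ _ f c g := by ext; simp

variable (a) in
/-- The forgetful functor. -/
@[simps]
def forget : EquivariantObject a ⥤ A where
  obj M := M.X
  map f := f.hom

instance : (forget a).Additive where

instance : (forget a).Faithful where
  map_injective h := hom_ext h

instance : (forget a).ReflectsIsomorphisms where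
  reflects {M N} f h := by
    have h' : IsIso f.hom := h
    refine ⟨⟨⟨inv f.hom, fun g => ?_⟩, ?_, ?_⟩⟩
    · rw [IsIso.inv_comp_eq, f.comm_assoc, ← Functor.map_comp, IsIso.hom_inv_id,
        CategoryTheory.Functor.map_id, Category.comp_id]
    · ext; simp
    · ext; simp

/-! The forgetful functor creates limits and colimits. -/

section Limits

lemma mul_comm_aux (a : LinearAction k G A) (g h : G) {P Q : A} (p : P ⟶ Q)
    {βg : P ⟶ (a.F g).obj P} {βh : P ⟶ (a.F h).obj P}
    {γg : Q ⟶ (a.F g).obj Q} {γh : Q ⟶ (a.F h).obj Q}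
    (hg : βg ≫ (a.F g).map p = p ≫ γg) (hh : βh ≫ (a.F h).map p = p ≫ γh) :
    (βg ≫ (a.F g).map βh ≫ (a.ε g h).hom.app P) ≫ (a.F (g * h)).map p =
      p ≫ γg ≫ (a.F g).map γh ≫ (a.ε g h).hom.app Q := by
  have e := (a.ε g h).hom.naturality p
  simp only [Functor.comp_map] at e
  rw [Category.assoc, Category.assoc, ← e, ← Functor.map_comp_assoc, hh, Functor.map_comp_assoc,
    ← Category.assoc, hg, Category.assoc]

variable {J : Type*} [Category* J] (K : J ⥤ EquivariantObject a)

/-- The structure maps of a diagram of equivariant objects, as a natural isomorphism. -/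
def diagramIso (g : G) : K ⋙ forget a ≅ (K ⋙ forget a) ⋙ a.F g :=
  NatIso.ofComponents (fun j => (K.obj j).α g) (fun f => (K.map f).comm g)

variable {K}

/-- The structure isomorphism on the apex of a limit cone. -/
noncomputable def limitα {c : Cone (K ⋙ forget a)} (hc : IsLimit c) (g : G) :
    c.pt ≅ (a.F g).obj c.pt :=
  hc.conePointsIsoOfNatIso (isLimitOfPreserves (a.F g) hc) (diagramIso K g)

lemma limitα_π {c : Cone (K ⋙ forget a)} (hc : IsLimit c) (g : G) (j : J) :
    (limitα hc g).hom ≫ (a.F g).map (c.π.app j) = c.π.app j ≫ ((K.obj j).α g).hom :=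
  hc.conePointsIsoOfNatIso_hom_comp (isLimitOfPreserves (a.F g) hc) (diagramIso K g) j

lemma limitα_mul {c : Cone (K ⋙ forget a)} (hc : IsLimit c) (g h : G) :
    (limitα hc (g * h)).hom =
      (limitα hc g).hom ≫ (a.F g).map (limitα hc h).hom ≫ (a.ε g h).hom.app c.pt := by
  refine (isLimitOfPreserves (a.F (g * h)) hc).hom_ext fun j => ?_
  refine (limitα_π hc (g * h) j).trans ?_
  rw [(K.obj j).α_mul]
  exact (mul_comm_aux a g h (c.π.app j) (limitα_π hc g j) (limitα_π hc h j)).symm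

/-- The limit cone of equivariant objects. -/
noncomputable def limitCone {c : Cone (K ⋙ forget a)} (hc : IsLimit c) : Cone K where
  pt := ⟨c.pt, limitα hc, limitα_mul hc⟩
  π :=
    { app := fun j => ⟨c.π.app j, fun g => (limitα_π hc g j).symm⟩
      naturality := fun _ _ f => hom_ext (c.π.naturality f) }

/-- The limit cone of equivariant objects is a limit cone. -/
noncomputable def limitConeIsLimit {c : Cone (K ⋙ forget a)} (hc : IsLimit c) :
    IsLimit (limitCone hc) where
  lift s :=
    { hom := hc.lift ((forget a).mapCone s)
      comm := fun g => (isLimitOfPreserves (a.F g) hc).hom_ext fun j =>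
        lift_aux (a.F g) _ (c.π.app j) (s.π.app j).hom (hc.fac ((forget a).mapCone s) j)
          (limitα_π hc g j) ((s.π.app j).comm g) }
  fac s j := hom_ext (hc.fac ((forget a).mapCone s) j)
  uniq s m h := hom_ext (hc.uniq ((forget a).mapCone s) m.hom
    fun j => congrArg (fun f => f.hom) (h j))

instance [HasLimitsOfShape J A] : HasLimitsOfShape J (EquivariantObject a) where
  has_limit K := ⟨⟨⟨_, limitConeIsLimit (limit.isLimit (K ⋙ forget a))⟩⟩⟩

instance [HasLimitsOfShape J A] : PreservesLimitsOfShape J (forget a) where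
  preservesLimit {K} := preservesLimit_of_preserves_limit_cone
    (limitConeIsLimit (limit.isLimit (K ⋙ forget a))) (limit.isLimit (K ⋙ forget a))

/-- The structure isomorphism on the apex of a colimit cocone. -/
noncomputable def colimitα {c : Cocone (K ⋙ forget a)} (hc : IsColimit c) (g : G) :
    c.pt ≅ (a.F g).obj c.pt :=
  hc.coconePointsIsoOfNatIso (isColimitOfPreserves (a.F g) hc) (diagramIso K g)

lemma ι_colimitα {c : Cocone (K ⋙ forget a)} (hc : IsColimit c) (g : G) (j : J) :
    c.ι.app j ≫ (colimitα hc g).hom = ((K.obj j).α g).hom ≫ (a.F g).map (c.ι.app j) :=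
  hc.comp_coconePointsIsoOfNatIso_hom (isColimitOfPreserves (a.F g) hc) (diagramIso K g) j

lemma colimitα_mul {c : Cocone (K ⋙ forget a)} (hc : IsColimit c) (g h : G) :
    (colimitα hc (g * h)).hom =
      (colimitα hc g).hom ≫ (a.F g).map (colimitα hc h).hom ≫ (a.ε g h).hom.app c.pt := by
  refine hc.hom_ext fun j => ?_
  refine (ι_colimitα hc (g * h) j).trans ?_
  rw [(K.obj j).α_mul]
  exact mul_comm_aux a g h (c.ι.app j) (ι_colimitα hc g j).symm (ι_colimitα hc h j).symm

/-- The colimit cocone of equivariant objects. -/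
noncomputable def colimitCocone {c : Cocone (K ⋙ forget a)} (hc : IsColimit c) : Cocone K where
  pt := ⟨c.pt, colimitα hc, colimitα_mul hc⟩
  ι :=
    { app := fun j => ⟨c.ι.app j, fun g => ι_colimitα hc g j⟩
      naturality := fun _ _ f => hom_ext (c.ι.naturality f) }

/-- The colimit cocone of equivariant objects is a colimit cocone. -/
noncomputable def colimitCoconeIsColimit {c : Cocone (K ⋙ forget a)} (hc : IsColimit c) :
    IsColimit (colimitCocone hc) where
  desc s :=
    { hom := hc.desc ((forget a).mapCocone s)
      comm := fun g => hc.hom_ext fun j =>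
        desc_aux (a.F g) _ (c.ι.app j) (s.ι.app j).hom (hc.fac ((forget a).mapCocone s) j)
          (ι_colimitα hc g j) ((s.ι.app j).comm g) }
  fac s j := hom_ext (hc.fac ((forget a).mapCocone s) j)
  uniq s m h := hom_ext (hc.uniq ((forget a).mapCocone s) m.hom
    fun j => congrArg (fun f => f.hom) (h j))

instance [HasColimitsOfShape J A] : HasColimitsOfShape J (EquivariantObject a) where
  has_colimit K := ⟨⟨⟨_, colimitCoconeIsColimit (colimit.isColimit (K ⋙ forget a))⟩⟩⟩

instance [HasColimitsOfShape J A] : PreservesColimitsOfShape J (forget a) where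
  preservesColimit {K} := preservesColimit_of_preserves_colimit_cocone
    (colimitCoconeIsColimit (colimit.isColimit (K ⋙ forget a)))
    (colimit.isColimit (K ⋙ forget a))

end Limits

instance : HasKernels (EquivariantObject a) where
instance : HasCokernels (EquivariantObject a) where
instance : HasFiniteProducts (EquivariantObject a) where
  out _ := inferInstance

instance (f : M ⟶ N) : IsIso (Abelian.coimageImageComparison f) := by
  have : IsIso ((forget a).map (Abelian.coimageImageComparison f)) := by
    have e := Abelian.PreservesCoimageImageComparison.iso (forget a) f
    exact ((MorphismProperty.isomorphisms A).arrow_mk_iso_iff e).mpr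
      (inferInstanceAs (IsIso (Abelian.coimageImageComparison ((forget a).map f))))
  exact isIso_of_reflects_iso _ (forget a)

/-- The category of equivariant objects is abelian. -/
noncomputable instance : Abelian (EquivariantObject a) :=
  Abelian.ofCoimageImageComparisonIsIso

/-- The category of equivariant objects is Hom-finite. -/
instance [HomFinite k A] : HomFinite k (EquivariantObject a) where
  finite M N :=
    have := HomFinite.finite (k := k) M.X N.X
    Module.Finite.of_injective
      ({ toFun := fun f => f.hom
         map_add' := fun _ _ => rfl
         map_smul' := fun _ _ => rfl } : (M ⟶ N) →ₗ[k] (M.X ⟶ N.X))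
      hom_injective

end EquivariantObject

end Equivariant

end Equivariantization

/-! The Serre functor `S` lifts to equivariant objects because Serre duality is canonical. Write the
duality as a perfect pairing of `Hom(Y, S X)` with `Ext¹(X, Y)`. Each `F g` acts bijectively on both
sides, so requiring the pairing to be invariant under `F g` determines an isomorphism `F g (S X) ≅ S
(F g X)`. Its uniqueness gives naturality and compatibility with `ε` (`comparison_naturality`,
`comparison_mul`).

Duality upstairs comes from taking invariants. `Hom` of equivariant objects consists of the
conjugation-invariant morphisms. Induction gives a transfer on `Ext¹` whose two composites with
restriction are multiplication by `|G|` and the sum over the group action (`transfer_res`,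
`res_transfer`). As `|G|` is invertible, averaging shows that the invariant pairing stays perfect
(`equivariantPairing_bijective`).

Periodicity is the subtle point: an isomorphism `θ : S^d ≅ Id` need not be equivariant. Since `F g`
is fully faithful, its failure at `g` is a unit of the center. As the `F g` fix the center, these
units are multiplicative in `g` (`defect_mul`), so their `|G|`-th powers are trivial. The lift of
`S^d` is the twist by this character, whence the lift of `S` has period dividing `d * |G|`
(`isPeriodic_lift`). -/

namespace Equivariantization

/-! ### `Ext¹` by short exact sequences, and its functoriality under exact functors. -/

section ExtPresentation

universe w' v' u' w'' v'' u''

open Abelian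

variable {C : Type u} [Category.{v} C] [Abelian C]

/-- Every class in `Ext¹` is effaceable: it is killed by pulling back along some epimorphism. -/
lemma exists_epi_mk₀_comp_eq_zero [HasExt.{w} C] {X Y : C} (x : Ext X Y 1) :
    ∃ (P : C) (p : P ⟶ X), Epi p ∧ (Ext.mk₀ p).comp x (zero_add 1) = 0 := by
  let := HasDerivedCategory.standard C
  -- Identifies `Y[1]` with `Y` placed in degree `-1`, so that the class becomes a map between two
  -- single complexes.
  let e := ((DerivedCategory.singleFunctors C).shiftIso 1 (-1) 0 (by simp)).app Y
  let f : DerivedCategory.Q.obj ((HomologicalComplex.single C (.up ℤ) 0).obj X) ⟶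
      DerivedCategory.Q.obj ((HomologicalComplex.single C (.up ℤ) (-1)).obj Y) := x.hom ≫ e.hom
  -- A roof `X ← K → Y[1]` with `K` in degrees at most 0. The term `K.X 0` covers `X` because `s` is
  -- an isomorphism on `H⁰`, and it maps to `K` because `K` vanishes in degree 1. The class dies on
  -- it because `Y[1]` vanishes in degree 0.
  obtain ⟨K, hK, s, hs, g, hf⟩ := DerivedCategory.right_fac_of_isStrictlyLE f 0
  let σ : K.X 0 ⟶ X := s.f 0 ≫ (HomologicalComplex.singleObjXSelf (.up ℤ) 0 X).hom
  let i : (HomologicalComplex.single C (.up ℤ) 0).obj (K.X 0) ⟶ K :=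
    HomologicalComplex.mkHomFromSingle (𝟙 _) (fun k hk =>
      (CochainComplex.isZero_of_isStrictlyLE K 0 k (by simp at hk; lia)).eq_of_tgt _ _)
  have his : i ≫ s = (HomologicalComplex.single C (.up ℤ) 0).map σ := by
    apply HomologicalComplex.from_single_hom_ext
    simp [i, σ, HomologicalComplex.single_map_f_self]
  have hig : i ≫ g = 0 := by
    apply HomologicalComplex.from_single_hom_ext
    exact (HomologicalComplex.isZero_single_obj_X (.up ℤ) (-1) Y 0 (by simp)).eq_of_tgt _ _
  refine ⟨K.X 0, σ, ?_, ?_⟩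
  · have hqs : QuasiIso s := (DerivedCategory.isIso_Q_map_iff_quasiIso _ s).1 hs
    let L := (HomologicalComplex.single C (.up ℤ) 0).obj X
    have : IsIso (L.iCycles 0) := L.isIso_iCycles 0 1 (by simp) (by simp [L])
    have : IsIso (L.homologyπ 0) := L.isIso_homologyπ (-1) 0 (by simp) (by simp [L])
    have h₁ : Epi (HomologicalComplex.cyclesMap s 0 ≫ L.homologyπ 0) := by
      rw [← HomologicalComplex.homologyπ_naturality]
      infer_instance
    have h₂ : Epi (HomologicalComplex.cyclesMap s 0) := by
      have := epi_comp (HomologicalComplex.cyclesMap s 0 ≫ L.homologyπ 0) (inv (L.homologyπ 0))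
      simpa using this
    have h₃ : Epi (K.iCycles 0 ≫ s.f 0) := by
      rw [← HomologicalComplex.cyclesMap_i]
      infer_instance
    have : Epi (s.f 0) := epi_of_epi (K.iCycles 0) _
    exact epi_comp _ _
  · ext
    rw [Ext.comp_hom, Ext.mk₀_hom, ShiftedHom.mk₀_comp, Ext.zero_hom, ← cancel_mono e.hom,
      Category.assoc, zero_comp]
    change DerivedCategory.Q.map ((HomologicalComplex.single C (.up ℤ) 0).map σ) ≫ f = 0
    rw [hf, ← his, Functor.map_comp, Category.assoc, IsIso.hom_inv_id_assoc, ← Functor.map_comp,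
      hig, Functor.map_zero]

/-- Every class in `Ext¹` is a pushout of the class of a short exact sequence. -/
lemma exists_extClass_comp_mk₀ [HasExt.{w} C] {X Y : C} (x : Ext X Y 1) :
    ∃ (K P : C) (i : K ⟶ P) (p : P ⟶ X) (h : i ≫ p = 0) (hS : (ShortComplex.mk i p h).ShortExact)
      (f : K ⟶ Y), x = hS.extClass.comp (Ext.mk₀ f) (add_zero 1) := by
  obtain ⟨P, p, hp, hx⟩ := exists_epi_mk₀_comp_eq_zero x
  have hS : (ShortComplex.mk (kernel.ι p) p (kernel.condition p)).ShortExact :=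
    { exact := ShortComplex.exact_kernel p }
  obtain ⟨y, hy⟩ := Ext.contravariant_sequence_exact₃ hS Y x hx (add_zero 1)
  obtain ⟨f, rfl⟩ := (Ext.mk₀_bijective _ _).2 y
  exact ⟨_, _, _, _, _, hS, f, hy.symm⟩

variable {D : Type u'} [Category.{v'} D] [Abelian D]

section

variable [HasExt.{w} C] [HasExt.{w'} D]

/-- The action of an exact functor on `Ext¹` is natural in the functor. -/
lemma mapExactFunctor_comp_natTrans {F F' : C ⥤ D}
    [F.Additive] [PreservesFiniteLimits F] [PreservesFiniteColimits F]
    [F'.Additive] [PreservesFiniteLimits F'] [PreservesFiniteColimits F'] (τ : F ⟶ F')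
    {X Y : C} (x : Ext X Y 1) :
    (x.mapExactFunctor F).comp (Ext.mk₀ (τ.app Y)) (add_zero 1) =
      (Ext.mk₀ (τ.app X)).comp (x.mapExactFunctor F') (zero_add 1) := by
  obtain ⟨K, P, i, p, h, hS, f, rfl⟩ := exists_extClass_comp_mk₀ x
  have e : (hS.extClass.mapExactFunctor F).comp (Ext.mk₀ (τ.app K)) (add_zero 1) =
      (Ext.mk₀ (τ.app X)).comp (hS.extClass.mapExactFunctor F') (zero_add 1) := by
    rw [Ext.mapExactFunctor_extClass, Ext.mapExactFunctor_extClass]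
    -- The components of `τ` form a morphism between the two image short exact sequences; the
    -- general case follows by pushing out.
    exact ShortComplex.ShortExact.extClass_naturality (hS.map_of_exact F) (hS.map_of_exact F')
      ((ShortComplex.mk i p h).mapNatTrans τ)
  rw [Ext.mapExactFunctor_comp, Ext.mapExactFunctor_comp, Ext.mapExactFunctor_mk₀,
    Ext.mapExactFunctor_mk₀, Ext.comp_assoc_of_third_deg_zero, Ext.mk₀_comp_mk₀, τ.naturality,
    ← Ext.mk₀_comp_mk₀, ← Ext.comp_assoc_of_third_deg_zero, e, Ext.comp_assoc_of_third_deg_zero]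

lemma mapExactFunctor_id {X Y : C} (x : Ext X Y 1) : x.mapExactFunctor (𝟭 C) = x := by
  obtain ⟨K, P, i, p, h, hS, f, rfl⟩ := exists_extClass_comp_mk₀ x
  rw [Ext.mapExactFunctor_comp, Ext.mapExactFunctor_extClass, Ext.mapExactFunctor_mk₀]
  rfl

end

lemma mapExactFunctor_comp_functor {E : Type u''} [Category.{v''} E] [Abelian E]
    [HasExt.{w} C] [HasExt.{w'} D] [HasExt.{w''} E] (F : C ⥤ D) (F' : D ⥤ E)
    [F.Additive] [PreservesFiniteLimits F] [PreservesFiniteColimits F]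
    [F'.Additive] [PreservesFiniteLimits F'] [PreservesFiniteColimits F']
    {X Y : C} (x : Ext X Y 1) :
    x.mapExactFunctor (F ⋙ F') = (x.mapExactFunctor F).mapExactFunctor F' := by
  obtain ⟨K, P, i, p, h, hS, f, rfl⟩ := exists_extClass_comp_mk₀ x
  have e : hS.extClass.mapExactFunctor (F ⋙ F') =
      (hS.extClass.mapExactFunctor F).mapExactFunctor F' := by
    rw [Ext.mapExactFunctor_extClass, Ext.mapExactFunctor_extClass]
    exact (Ext.mapExactFunctor_extClass F' (hS.map_of_exact F)).symm
  rw [Ext.mapExactFunctor_comp, Ext.mapExactFunctor_comp, Ext.mapExactFunctor_mk₀,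
    Ext.mapExactFunctor_mk₀, Ext.mapExactFunctor_comp, Ext.mapExactFunctor_mk₀, e]
  rfl

end ExtPresentation

/-! ### Powers of functors, equivariant functors and their lifts, periodicity. -/

section

lemma IsCenterLinear.map_app {A : Type u} [Category.{v} A] {F : A ⥤ A} (hF : IsCenterLinear F)
    (z : CatCenter A) (X : A) : F.map (z.app X) = z.app (F.obj X) := by
  simpa [CatCenter.smul_eq] using hF z (𝟙 X)

section FunctorPow

variable {A : Type u} [Category.{v} A]

/-- The powers of an endofunctor are compatible with addition of exponents. -/
def functorPowAdd (F : A ⥤ A) (m : ℕ) : (n : ℕ) →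
    (functorPow F m ⋙ functorPow F n ≅ functorPow F (m + n))
  | 0 => Functor.rightUnitor _
  | n + 1 => (Functor.associator _ _ _).symm ≪≫ Functor.isoWhiskerRight (functorPowAdd F m n) F

/-- The powers of an endofunctor are compatible with multiplication of exponents. -/
def functorPowMul (F : A ⥤ A) (m : ℕ) : (n : ℕ) →
    (functorPow (functorPow F m) n ≅ functorPow F (m * n))
  | 0 => Iso.refl _
  | n + 1 => Functor.isoWhiskerRight (functorPowMul F m n) _ ≪≫ functorPowAdd F (m * n) m

lemma IsPeriodic.of_functorPow {F : A ⥤ A} {m : ℕ} (hm : 1 ≤ m) (h : IsPeriodic (functorPow F m)) :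
    IsPeriodic F := by
  obtain ⟨n, hn, ⟨e⟩⟩ := h
  exact ⟨m * n, Nat.mul_pos hm hn, ⟨(functorPowMul F m n).symm ≪≫ e⟩⟩

/-- A periodic endofunctor is an equivalence. -/
lemma IsPeriodic.isEquivalence {F : A ⥤ A} (h : IsPeriodic F) : F.IsEquivalence := by
  obtain ⟨n, hn, ⟨e⟩⟩ := h
  obtain ⟨m, rfl⟩ := Nat.exists_eq_add_of_le hn
  let e' : functorPow F 1 ⋙ functorPow F m ≅ 𝟭 A := functorPowAdd F 1 m ≪≫ e
  let e₁ : F ⋙ functorPow F m ≅ 𝟭 A := e'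
  have h₁ : (F ⋙ functorPow F m).Faithful := Functor.Faithful.of_iso e₁.symm
  have h₂ : F.Faithful := Functor.Faithful.of_comp F (functorPow F m)
  -- The exponent is `1 + m`, while the recursion unfolds `m + 1`.
  let e₂ : functorPow F m ⋙ F ≅ 𝟭 A := eqToIso (by rw [add_comm]; rfl) ≪≫ e
  exact (CategoryTheory.Equivalence.mk F (functorPow F m) e₁.symm e₂).isEquivalence_functor

end FunctorPow

variable {k : Type t} [Field k] {G : Type s} [Group G]
  {A : Type u} [Category.{v} A] [Abelian A] [Linear k A]

/-- A natural isomorphism `T ∘ F g ≅ F g ∘ T` for every `g`, compatible with the isomorphisms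
`F g ∘ F h ≅ F (g * h)`. -/
structure EquivariantStructure (a : LinearAction k G A) (T : A ⥤ A) where
  τ (g : G) : a.F g ⋙ T ≅ T ⋙ a.F g
  coherence (g h : G) (X : A) :
    T.map ((a.ε g h).hom.app X) ≫ (τ (g * h)).hom.app X =
      (τ g).hom.app ((a.F h).obj X) ≫ (a.F g).map ((τ h).hom.app X) ≫
        (a.ε g h).hom.app (T.obj X)

namespace EquivariantStructure

variable {a : LinearAction k G A} {T T' : A ⥤ A}

lemma τ_naturality (s : EquivariantStructure a T) (g : G) {X Y : A} (f : X ⟶ Y) :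
    T.map ((a.F g).map f) ≫ (s.τ g).hom.app Y = (s.τ g).hom.app X ≫ (a.F g).map (T.map f) :=
  (s.τ g).hom.naturality f

lemma ε_naturality (a : LinearAction k G A) (g h : G) {X Y : A} (f : X ⟶ Y) :
    (a.F g).map ((a.F h).map f) ≫ (a.ε g h).hom.app Y =
      (a.ε g h).hom.app X ≫ (a.F (g * h)).map f :=
  (a.ε g h).hom.naturality f

/-- The identity functor is equivariant. -/
def id (a : LinearAction k G A) : EquivariantStructure a (𝟭 A) where
  τ g := Functor.rightUnitor _ ≪≫ (Functor.leftUnitor _).symm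
  coherence g h X := by simp

/-- The composition of equivariant functors. -/
def comp (s : EquivariantStructure a T) (s' : EquivariantStructure a T') :
    EquivariantStructure a (T ⋙ T') where
  τ g := NatIso.ofComponents
    (fun X => T'.mapIso ((s.τ g).app X) ≪≫ (s'.τ g).app (T.obj X)) (fun {X Y} f => by
      simp only [Functor.comp_map, Iso.trans_hom, Functor.mapIso_hom, Iso.app_hom,
        Category.assoc]
      rw [← s'.τ_naturality, ← Functor.map_comp_assoc, s.τ_naturality, Functor.map_comp_assoc])
  coherence g h X := by
    simp only [NatIso.ofComponents_hom_app, Functor.comp_map, Iso.trans_hom, Functor.mapIso_hom,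
      Iso.app_hom, Category.assoc, Functor.map_comp, Functor.comp_obj]
    rw [← Functor.map_comp_assoc, s.coherence, Functor.map_comp, Functor.map_comp, Category.assoc,
      Category.assoc, s'.coherence]
    have := s'.τ_naturality g ((s.τ h).hom.app X)
    simp only [Functor.comp_obj] at this ⊢
    rw [reassoc_of% this]

/-- The powers of an equivariant functor. -/
def pow (s : EquivariantStructure a T) : (n : ℕ) → EquivariantStructure a (functorPow T n)
  | 0 => id a
  | n + 1 => (s.pow n).comp s

/-- An equivariant functor induces a functor between equivariant objects. -/
@[simps]
def lift (s : EquivariantStructure a T) : EquivariantObject a ⥤ EquivariantObject a where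
  obj M :=
    { X := T.obj M.X
      α := fun g => T.mapIso (M.α g) ≪≫ (s.τ g).app M.X
      α_mul := fun g h => by
        simp only [Iso.trans_hom, Functor.mapIso_hom, Iso.app_hom, M.α_mul, Functor.map_comp,
          Category.assoc, s.coherence]
        have := s.τ_naturality g (M.α h).hom
        rw [reassoc_of% this] }
  map {M N} f :=
    { hom := T.map f.hom
      comm := fun g => by
        simp only [Iso.trans_hom, Functor.mapIso_hom, Iso.app_hom, Category.assoc]
        rw [← Functor.map_comp_assoc, f.comm, Functor.map_comp_assoc, s.τ_naturality] }

instance (s : EquivariantStructure a T) [T.Additive] : s.lift.Additive where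
  map_add {_ _ f g} := EquivariantObject.hom_ext (T.map_add (f := f.hom) (g := g.hom))

instance (s : EquivariantStructure a T) [T.Linear k] : s.lift.Linear k where
  map_smul f c := EquivariantObject.hom_ext (T.map_smul c f.hom)

end EquivariantStructure

variable {a : LinearAction k G A}

/-- An isomorphism between equivariant objects from an isomorphism of the underlying objects. -/
def EquivariantObject.isoMk {M N : EquivariantObject a} (e : M.X ≅ N.X)
    (he : ∀ g, e.hom ≫ (N.α g).hom = (M.α g).hom ≫ (a.F g).map e.hom) : M ≅ N where
  hom := ⟨e.hom, he⟩
  inv := ⟨e.inv, fun g => by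
    rw [Iso.inv_comp_eq, ← Category.assoc, he, Category.assoc, ← Functor.map_comp, e.hom_inv_id,
      CategoryTheory.Functor.map_id, Category.comp_id]⟩
  hom_inv_id := hom_ext e.hom_inv_id
  inv_hom_id := hom_ext e.inv_hom_id

namespace EquivariantStructure

variable {T T' : A ⥤ A}

/-- Lifting equivariant functors is compatible with composition. -/
def liftComp (s : EquivariantStructure a T) (s' : EquivariantStructure a T') :
    s.lift ⋙ s'.lift ≅ (s.comp s').lift :=
  NatIso.ofComponents
    (fun M => EquivariantObject.isoMk (Iso.refl (T'.obj (T.obj M.X))) (fun g => by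
      change 𝟙 (T'.obj (T.obj M.X)) ≫ T'.map (T.map (M.α g).hom) ≫
          T'.map ((s.τ g).hom.app M.X) ≫ (s'.τ g).hom.app (T.obj M.X) =
        (T'.map (T.map (M.α g).hom ≫ (s.τ g).hom.app M.X) ≫ (s'.τ g).hom.app (T.obj M.X)) ≫
          (a.F g).map (𝟙 (T'.obj (T.obj M.X)))
      simp))
    (fun {M N} f => by
      ext
      change T'.map (T.map f.hom) ≫ 𝟙 (T'.obj (T.obj N.X)) =
        𝟙 (T'.obj (T.obj M.X)) ≫ T'.map (T.map f.hom)
      rw [Category.id_comp, Category.comp_id])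

/-- Lifting equivariant functors is compatible with powers. -/
def liftPow (s : EquivariantStructure a T) : (n : ℕ) → (functorPow s.lift n ≅ (s.pow n).lift)
  | 0 => NatIso.ofComponents
      (fun M => EquivariantObject.isoMk (Iso.refl M.X) (fun g => by
        change 𝟙 M.X ≫ (M.α g).hom ≫ 𝟙 _ ≫ 𝟙 _ = (M.α g).hom ≫ (a.F g).map (𝟙 M.X)
        simp))
      (fun {M N} f => by
        ext
        change f.hom ≫ 𝟙 N.X = 𝟙 M.X ≫ f.hom
        rw [Category.id_comp, Category.comp_id])
  | n + 1 => Functor.isoWhiskerRight (s.liftPow n) s.lift ≪≫ (s.pow n).liftComp s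

end EquivariantStructure

/-- An endofunctor of the equivariant objects is the twist by the central elements `c g` if it is
the identity on underlying objects and rescales the structure maps by `c g`. -/
def IsTwist (T : EquivariantObject a ⥤ EquivariantObject a) (c : G → CatCenter A) : Prop :=
  ∃ θ : ∀ M, (T.obj M).X ≅ M.X,
    (∀ ⦃M N⦄ (f : M ⟶ N), (T.map f).hom ≫ (θ N).hom = (θ M).hom ≫ f.hom) ∧
    ∀ M g, ((T.obj M).α g).hom ≫ (a.F g).map (θ M).hom =
      (θ M).hom ≫ (M.α g).hom ≫ (c g).app ((a.F g).obj M.X)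

namespace IsTwist

variable {T T' : EquivariantObject a ⥤ EquivariantObject a} {c c' : G → CatCenter A}

lemma nonempty_iso_id (h : IsTwist T 1) : Nonempty (T ≅ 𝟭 _) := by
  obtain ⟨θ, hθ, hc⟩ := h
  refine ⟨NatIso.ofComponents (fun M => EquivariantObject.isoMk (θ M) (fun g => ?_))
    (fun f => EquivariantObject.hom_ext (hθ f))⟩
  refine Eq.trans ?_ (hc M g).symm
  change _ = _ ≫ _ ≫ 𝟙 ((a.F g).obj M.X)
  rw [Category.comp_id]
  rfl

lemma id : IsTwist (𝟭 (EquivariantObject a)) 1 := by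
  refine ⟨fun M => Iso.refl M.X, fun M N f => ?_, fun M g => ?_⟩
  · change f.hom ≫ 𝟙 N.X = 𝟙 M.X ≫ f.hom
    simp
  · change (M.α g).hom ≫ (a.F g).map (𝟙 M.X) = 𝟙 M.X ≫ (M.α g).hom ≫ 𝟙 ((a.F g).obj M.X)
    simp

lemma comp (h : IsTwist T c) (h' : IsTwist T' c') : IsTwist (T ⋙ T') (c * c') := by
  obtain ⟨θ, hθ, hc⟩ := h
  obtain ⟨θ', hθ', hc'⟩ := h'
  refine ⟨fun M => θ' (T.obj M) ≪≫ θ M, fun M N f => ?_, fun M g => ?_⟩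
  · change (T'.map (T.map f)).hom ≫ (θ' (T.obj N)).hom ≫ (θ N).hom =
      ((θ' (T.obj M)).hom ≫ (θ M).hom) ≫ f.hom
    rw [Category.assoc, ← hθ, ← Category.assoc, hθ', Category.assoc]
  · have e : ((c * c') g).app ((a.F g).obj M.X) =
      (c g).app ((a.F g).obj M.X) ≫ (c' g).app ((a.F g).obj M.X) := CatCenter.mul_app _ _ _
    have e' := (c' g).naturality ((a.F g).map (θ M).hom)
    change ((T'.obj (T.obj M)).α g).hom ≫ (a.F g).map ((θ' (T.obj M)).hom ≫ (θ M).hom) =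
      ((θ' (T.obj M)).hom ≫ (θ M).hom) ≫ _
    rw [e, Functor.map_comp, ← Category.assoc, hc', Category.assoc, Category.assoc, ← e',
      Category.assoc]
    congr 1
    rw [← Category.assoc, hc, Category.assoc, Category.assoc]

lemma functorPow (h : IsTwist T c) : ∀ n : ℕ, IsTwist (functorPow T n) (c ^ n)
  | 0 => by rw [pow_zero]; exact id
  | n + 1 => by rw [pow_succ]; exact (h.functorPow n).comp h

lemma of_iso (h : IsTwist T c) (e : T' ≅ T) : IsTwist T' c := by
  obtain ⟨θ, hθ, hc⟩ := h
  refine ⟨fun M => (EquivariantObject.forget a).mapIso (e.app M) ≪≫ θ M,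
    fun M N f => ?_, fun M g => ?_⟩
  · have h₁ : (T'.map f).hom ≫ (e.hom.app N).hom = (e.hom.app M).hom ≫ (T.map f).hom :=
      congrArg (fun φ => EquivariantObject.Hom.hom φ) (e.hom.naturality f)
    change (T'.map f).hom ≫ (e.hom.app N).hom ≫ (θ N).hom =
      ((e.hom.app M).hom ≫ (θ M).hom) ≫ f.hom
    rw [← Category.assoc, h₁, Category.assoc, Category.assoc, hθ]
  · change ((T'.obj M).α g).hom ≫ (a.F g).map ((e.hom.app M).hom ≫ (θ M).hom) =
      ((e.hom.app M).hom ≫ (θ M).hom) ≫ _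
    rw [Functor.map_comp, Category.assoc, ← hc]
    exact ((e.hom.app M).comm_assoc g _).symm

end IsTwist

/-! ### The central character obstructing equivariance of a trivialization. -/

namespace EquivariantStructure

variable {T : A ⥤ A} (s : EquivariantStructure a T) (θ : T ≅ 𝟭 A)

/-- The automorphism of `F g` that measures the failure of `θ` to be equivariant. -/
def defectAux (g : G) (X : A) : (a.F g).obj X ⟶ (a.F g).obj X :=
  θ.inv.app ((a.F g).obj X) ≫ (s.τ g).hom.app X ≫ (a.F g).map (θ.hom.app X)

lemma τ_comp_map (g : G) (X : A) : (s.τ g).hom.app X ≫ (a.F g).map (θ.hom.app X) =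
    θ.hom.app ((a.F g).obj X) ≫ s.defectAux θ g X := by
  simp [defectAux]

lemma map_comp_defectAux (g : G) {X Y : A} (f : X ⟶ Y) :
    (a.F g).map f ≫ s.defectAux θ g Y = s.defectAux θ g X ≫ (a.F g).map f := by
  have h₁ := θ.inv.naturality ((a.F g).map f)
  have h₂ := s.τ_naturality g f
  have h₃ := θ.hom.naturality f
  simp only [Functor.id_map] at h₁ h₃
  simp only [defectAux, Category.assoc]
  rw [reassoc_of% h₁, reassoc_of% h₂, ← Functor.map_comp, h₃, Functor.map_comp]

/-- The central element that measures the failure of `θ` to be equivariant. -/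
noncomputable def defect (g : G) : CatCenter A where
  app X := (a.F g).preimage (s.defectAux θ g X)
  naturality X Y f := (a.F g).map_injective (by simp [map_comp_defectAux])

lemma map_defect_app (g : G) (X : A) :
    (a.F g).map ((s.defect θ g).app X) = s.defectAux θ g X :=
  (a.F g).map_preimage _

lemma isUnit_defect (g : G) : IsUnit (s.defect θ g) := by
  have : ∀ X, IsIso ((s.defect θ g).app X) := fun X => by
    have : IsIso ((a.F g).map ((s.defect θ g).app X)) := by
      rw [map_defect_app, defectAux]
      infer_instance
    exact isIso_of_reflects_iso _ (a.F g)
  have : IsIso (C := A ⥤ A) (s.defect θ g) := NatIso.isIso_of_isIso_app (s.defect θ g)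
  rw [isUnit_iff_isIso]
  exact this

variable (hZ : ∀ g : G, IsCenterLinear (a.F g))

include hZ

/-- Both sides can be compared after the faithful functor `F h ⋙ F g`. Center-linearity turns `F h`
of the defect of `g` at `X` into that defect at `F h X`; the coherence of `τ` and the naturality of
`θ` and `ε` do the rest. -/
lemma defect_mul (g h : G) : s.defect θ (g * h) = s.defect θ g * s.defect θ h := by
  ext X
  apply (a.F h).map_injective
  apply (a.F g).map_injective
  rw [CatCenter.mul_app, Functor.map_comp, Functor.map_comp, (hZ h).map_app (s.defect θ g),
    map_defect_app, map_defect_app, ← cancel_mono ((a.ε g h).hom.app X), ε_naturality,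
    map_defect_app, ← cancel_epi (θ.hom.app _)]
  have h₁ := θ.hom.naturality ((a.ε g h).hom.app X)
  have h₂ := s.coherence g h X
  have h₃ := s.τ_comp_map θ g ((a.F h).obj X)
  simp only [Functor.comp_obj, Functor.id_map, Functor.id_obj] at *
  rw [← reassoc_of% h₁, ← τ_comp_map, reassoc_of% h₂, Category.assoc, ← ε_naturality,
    ← Functor.map_comp_assoc, τ_comp_map, Functor.map_comp, Category.assoc, reassoc_of% h₃]
  rfl

lemma defect_pow_card [Finite G] : s.defect θ ^ Nat.card G = 1 := by
  -- Multiplicativity makes this element idempotent, and an idempotent unit is 1.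
  have h1 : s.defect θ 1 = 1 := by
    have := s.defect_mul θ hZ 1 1
    rw [mul_one] at this
    exact (s.isUnit_defect θ 1).mul_eq_left.1 this.symm
  let f : G →* CatCenter A := ⟨⟨s.defect θ, h1⟩, s.defect_mul θ hZ⟩
  ext1 g
  change (f g) ^ Nat.card G = 1
  rw [← map_pow, pow_card_eq_one', map_one]

/-- The isomorphism on underlying objects is `θ` itself; moving it past the lifted structure map
leaves exactly the defect. -/
lemma isTwist_lift : IsTwist s.lift (s.defect θ) := by
  refine ⟨fun M => θ.app M.X, fun M N f => θ.hom.naturality f.hom, fun M g => ?_⟩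
  have h₁ := θ.hom.naturality (M.α g).hom
  have h₂ := s.τ_comp_map θ g M.X
  change (T.map (M.α g).hom ≫ (s.τ g).hom.app M.X) ≫ (a.F g).map (θ.hom.app M.X) =
    θ.hom.app M.X ≫ (M.α g).hom ≫ _
  simp only [Functor.id_map] at h₁
  rw [Category.assoc, h₂, reassoc_of% h₁, ← (hZ g).map_app, map_defect_app]

/-- If the functor `T` is periodic, then so is the functor on equivariant objects. -/
lemma isPeriodic_lift [Finite G] (hT : IsPeriodic T) : IsPeriodic s.lift := by
  obtain ⟨d, hd, ⟨θ⟩⟩ := hT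
  refine IsPeriodic.of_functorPow hd ⟨Nat.card G, Nat.card_pos, ?_⟩
  have := ((((s.pow d).isTwist_lift θ hZ).of_iso (s.liftPow d))).functorPow (Nat.card G)
  rw [defect_pow_card _ _ hZ] at this
  exact this.nonempty_iso_id

end EquivariantStructure

end

section

open Abelian

/-! ### Calculus of pullbacks and pushouts in `Ext¹`; equivalences act bijectively. -/

section PullPush

universe w' v' u'

variable {C : Type u} [Category.{v} C] [Abelian C] [HasExt.{w} C]

/-- The pullback of a class in `Ext¹`. -/
noncomputable def pull {X' X Y : C} (f : X' ⟶ X) (x : Ext X Y 1) : Ext X' Y 1 :=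
  (Ext.mk₀ f).comp x (zero_add 1)

/-- The pushout of a class in `Ext¹`. -/
noncomputable def push {X Y Y' : C} (g : Y ⟶ Y') (x : Ext X Y 1) : Ext X Y' 1 :=
  x.comp (Ext.mk₀ g) (add_zero 1)

lemma pull_id {X Y : C} (x : Ext X Y 1) : pull (𝟙 X) x = x := by simp [pull]

lemma push_id {X Y : C} (x : Ext X Y 1) : push (𝟙 Y) x = x := by simp [push]

lemma pull_comp {X'' X' X Y : C} (f : X'' ⟶ X') (f' : X' ⟶ X) (x : Ext X Y 1) :
    pull (f ≫ f') x = pull f (pull f' x) := by simp [pull]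

lemma push_comp {X Y Y' Y'' : C} (g : Y ⟶ Y') (g' : Y' ⟶ Y'') (x : Ext X Y 1) :
    push (g ≫ g') x = push g' (push g x) := by
  rw [push, push, push, Ext.comp_assoc_of_third_deg_zero, Ext.mk₀_comp_mk₀]

lemma push_pull {X' X Y Y' : C} (f : X' ⟶ X) (g : Y ⟶ Y') (x : Ext X Y 1) :
    push g (pull f x) = pull f (push g x) :=
  Ext.comp_assoc_of_third_deg_zero _ _ _ _

lemma pull_hom_inv {X' X Y : C} (e : X' ≅ X) (x : Ext X' Y 1) : pull e.hom (pull e.inv x) = x := by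
  rw [← pull_comp, e.hom_inv_id, pull_id]

lemma pull_inv_hom {X' X Y : C} (e : X ≅ X') (x : Ext X' Y 1) : pull e.inv (pull e.hom x) = x :=
  pull_hom_inv e.symm x

lemma push_hom_inv {X Y Y' : C} (e : Y ≅ Y') (x : Ext X Y' 1) : push e.hom (push e.inv x) = x := by
  rw [← push_comp, e.inv_hom_id, push_id]

lemma push_inv_hom {X Y Y' : C} (e : Y' ≅ Y) (x : Ext X Y' 1) : push e.inv (push e.hom x) = x :=
  push_hom_inv e.symm x

lemma push_sum {X Y Y' : C} {ι : Type*} [Fintype ι] (g : ι → (Y ⟶ Y')) (x : Ext X Y 1) :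
    push (∑ i, g i) x = ∑ i, push (g i) x := by
  rw [push, Ext.mk₀_sum, Ext.comp_sum]
  rfl

lemma push_nsmul {X Y Y' : C} (n : ℕ) (g : Y ⟶ Y') (x : Ext X Y 1) :
    push (n • g) x = n • push g x := by
  have h : n • g = ∑ _ : Fin n, g := by simp
  rw [h, push_sum]
  simp

variable {D : Type u'} [Category.{v'} D] [Abelian D] [HasExt.{w'} D]

section

variable (F : C ⥤ D) [F.Additive] [PreservesFiniteLimits F] [PreservesFiniteColimits F]

lemma mapExactFunctor_pull {X' X Y : C} (f : X' ⟶ X) (x : Ext X Y 1) :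
    (pull f x).mapExactFunctor F = pull (F.map f) (x.mapExactFunctor F) := by
  rw [pull, pull, Ext.mapExactFunctor_comp, Ext.mapExactFunctor_mk₀]

lemma mapExactFunctor_push {X Y Y' : C} (g : Y ⟶ Y') (x : Ext X Y 1) :
    (push g x).mapExactFunctor F = push (F.map g) (x.mapExactFunctor F) := by
  rw [push, push, Ext.mapExactFunctor_comp, Ext.mapExactFunctor_mk₀]

variable {F}

lemma push_app_mapExactFunctor {F' : C ⥤ D} [F'.Additive] [PreservesFiniteLimits F']
    [PreservesFiniteColimits F'] (τ : F ⟶ F') {X Y : C} (x : Ext X Y 1) :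
    push (τ.app Y) (x.mapExactFunctor F) = pull (τ.app X) (x.mapExactFunctor F') :=
  mapExactFunctor_comp_natTrans τ x

end

/-- Naturality of `Ext¹` along the unit `Id ≅ F.inv ∘ F` recovers a class from its image. -/
lemma mapExactFunctor_injective (F : C ⥤ D) [F.IsEquivalence] [F.Additive] {X Y : C} :
    Function.Injective (fun x : Ext X Y 1 => x.mapExactFunctor F) := fun x y h => by
  let e := F.asEquivalence
  have : F.asEquivalence.functor.Additive := inferInstanceAs F.Additive
  have : F.inv.Additive := inferInstanceAs F.asEquivalence.inverse.Additive
  have key (z : Ext X Y 1) : push (e.unitIso.hom.app Y) z =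
      pull (e.unitIso.hom.app X) ((z.mapExactFunctor F).mapExactFunctor F.inv) := by
    have := push_app_mapExactFunctor (F' := F ⋙ F.inv) e.unitIso.hom z
    rw [mapExactFunctor_id, mapExactFunctor_comp_functor] at this
    exact this
  have h' : push (e.unitIso.hom.app Y) x = push (e.unitIso.hom.app Y) y := by
    dsimp only at h
    rw [key, key, h]
  rw [← push_inv_hom (e.unitIso.app Y) x, ← push_inv_hom (e.unitIso.app Y) y]
  exact congrArg _ h'

lemma mapExactFunctor_bijective (F : C ⥤ D) [F.IsEquivalence] [F.Additive] {X Y : C} :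
    Function.Bijective (fun x : Ext X Y 1 => x.mapExactFunctor F) := by
  refine ⟨mapExactFunctor_injective F, fun y => ?_⟩
  let e := F.asEquivalence
  have : F.asEquivalence.functor.Additive := inferInstanceAs F.Additive
  have : F.inv.Additive := inferInstanceAs F.asEquivalence.inverse.Additive
  let z : Ext (F.inv.obj (F.obj X)) (F.inv.obj (F.obj Y)) 1 := y.mapExactFunctor F.inv
  let x : Ext X Y 1 := pull (e.unitIso.app X).hom (push (e.unitIso.app Y).inv z)
  -- The candidate `x` is `F.inv y` transported along the unit. Its image need only be compared with
  -- `y` after applying `F.inv`, which is also injective on `Ext¹`.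
  refine ⟨x, mapExactFunctor_injective F.inv ?_⟩
  have key : push (e.unitIso.app Y).hom x =
      pull (e.unitIso.app X).hom ((x.mapExactFunctor F).mapExactFunctor F.inv) := by
    have := push_app_mapExactFunctor (F' := F ⋙ F.inv) e.unitIso.hom x
    rw [mapExactFunctor_id, mapExactFunctor_comp_functor] at this
    exact this
  change (x.mapExactFunctor F).mapExactFunctor F.inv = z
  rw [← pull_inv_hom (e.unitIso.app X) z,
    ← pull_inv_hom (e.unitIso.app X) ((x.mapExactFunctor F).mapExactFunctor F.inv)]
  congr 1
  refine key.symm.trans ?_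
  exact (push_pull _ _ _).trans (congrArg _ (push_hom_inv (e.unitIso.app Y) z))

end PullPush

/-! ### The Serre pairing and the equivariance of the Serre functor. -/

section Pairing

variable {k : Type t} [Field k] {A : Type u} [Category.{v} A] [Abelian A] [Linear k A]
  [HomFinite k A] [HasExt.{w} A]

namespace SerreDuality

variable (D : SerreDuality k A)

/-- The perfect pairing between `Hom(Y, S X)` and `Ext¹(X, Y)`. -/
noncomputable def pairing {X Y : A} (u : Y ⟶ D.S.obj X) : Ext X Y 1 →ₗ[k] k :=
  (D.φ X Y).symm u

lemma pairing_injective {X Y : A} {u u' : Y ⟶ D.S.obj X}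
    (h : ∀ x, D.pairing u x = D.pairing u' x) : u = u' :=
  (D.φ X Y).symm.injective (LinearMap.ext h)

lemma pairing_φ {X Y : A} (l : Module.Dual k (Ext X Y 1)) : D.pairing (D.φ X Y l) = l :=
  (D.φ X Y).symm_apply_apply l

lemma pairing_comp {X Y Y' : A} (g : Y ⟶ Y') (u : Y' ⟶ D.S.obj X) (x : Ext X Y 1) :
    D.pairing (g ≫ u) x = D.pairing u (push g x) := by
  have h := D.naturality_right X g (D.pairing u)
  have h' : D.φ X Y' (D.pairing u) = u := (D.φ X Y').apply_symm_apply u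
  rw [h'] at h
  rw [← h, pairing_φ]
  rfl

lemma pairing_comp_map {X X' Y : A} (f : X ⟶ X') (u : Y ⟶ D.S.obj X) (x : Ext X' Y 1) :
    D.pairing (u ≫ D.S.map f) x = D.pairing u (pull f x) := by
  have h := D.naturality_left f Y (D.pairing u)
  have h' : D.φ X Y (D.pairing u) = u := (D.φ X Y).apply_symm_apply u
  rw [h'] at h
  rw [← h, pairing_φ]
  rfl

section

/-- The action of a linear auto-equivalence on `Ext¹`. -/
noncomputable def extEquiv {A : Type u} [Category.{v} A] [Abelian A] [HasExt.{w} A]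
    (F : A ⥤ A) [F.IsEquivalence] [F.Additive] (k : Type t) [Field k] [Linear k A] [F.Linear k]
    (X Y : A) : Ext X Y 1 ≃ₗ[k] Ext (F.obj X) (F.obj Y) 1 :=
  LinearEquiv.ofBijective (F.mapExtLinearMap k X Y 1) (mapExactFunctor_bijective F)

variable (F : A ⥤ A) [F.IsEquivalence] [F.Additive] [F.Linear k]

/-- The canonical morphism that compares the Serre functor with its conjugate by a linear
auto-equivalence. -/
noncomputable def comparison (X : A) : F.obj (D.S.obj X) ⟶ D.S.obj (F.obj X) :=
  D.φ _ _ (D.pairing (𝟙 (D.S.obj X)) ∘ₗ (extEquiv F k X (D.S.obj X)).symm.toLinearMap)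

/-- Invariance of the pairing under `F`, the property that characterizes `comparison`. It is built
in for `u = 𝟙`, and pushing `x` out along `u` reduces to that case. -/
lemma pairing_map_comp_comparison {X Y : A} (u : Y ⟶ D.S.obj X) (x : Ext X Y 1) :
    D.pairing (F.map u ≫ D.comparison F X) (x.mapExactFunctor F) = D.pairing u x := by
  rw [pairing_comp, comparison, pairing_φ, ← mapExactFunctor_push]
  change D.pairing (𝟙 _) ((extEquiv F k X (D.S.obj X)).symm (extEquiv F k X (D.S.obj X) (push u x))) = _
  rw [LinearEquiv.symm_apply_apply, ← pairing_comp, Category.comp_id]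

/-- Perfectness of the pairings and bijectivity of `F` on `Ext¹` make `u ↦ F.map u ≫ D.comparison F
X` bijective. Injectivity gives mono and surjectivity gives epi, as every object is isomorphic to
some `F.obj Y`. -/
instance isIso_comparison (X : A) : IsIso (D.comparison F X) := by
  have hinj {Y : A} {u : Y ⟶ D.S.obj X} (h : F.map u ≫ D.comparison F X = 0) : u = 0 :=
    D.pairing_injective fun x => by
      rw [← D.pairing_map_comp_comparison F, h]
      simp [pairing]
  have hsurj {Y : A} (w : F.obj Y ⟶ D.S.obj (F.obj X)) :
      ∃ u : Y ⟶ D.S.obj X, F.map u ≫ D.comparison F X = w := by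
    refine ⟨D.φ X Y (D.pairing w ∘ₗ (extEquiv F k X Y).toLinearMap), D.pairing_injective fun x => ?_⟩
    obtain ⟨y, rfl⟩ := (mapExactFunctor_bijective F).2 x
    dsimp only
    rw [D.pairing_map_comp_comparison F, pairing_φ]
    rfl
  have : Mono (D.comparison F X) := Preadditive.mono_of_cancel_zero _ fun {P} w hw => by
    obtain ⟨u, hu⟩ := F.map_surjective ((F.objObjPreimageIso P).hom ≫ w)
    have : u = 0 := hinj (by rw [hu, Category.assoc, hw, comp_zero])
    rw [this, F.map_zero] at hu
    exact (cancel_epi (F.objObjPreimageIso P).hom).1 (by rw [← hu, comp_zero])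
  have : Epi (D.comparison F X) := by
    obtain ⟨u, hu⟩ := hsurj (F.objObjPreimageIso (D.S.obj (F.obj X))).hom
    have : Epi (F.map u ≫ D.comparison F X) := by rw [hu]; infer_instance
    exact epi_of_epi (F.map u) _
  exact isIso_of_mono_of_epi _

lemma comparison_naturality {X X' : A} (f : X ⟶ X') :
    F.map (D.S.map f) ≫ D.comparison F X' = D.comparison F X ≫ D.S.map (F.map f) := by
  refine D.pairing_injective fun x => ?_
  obtain ⟨y, rfl⟩ := (mapExactFunctor_bijective F).2 x
  have h := D.pairing_map_comp_comparison F (𝟙 (D.S.obj X)) (pull f y)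
  rw [CategoryTheory.Functor.map_id, Category.id_comp] at h
  dsimp only
  rw [pairing_map_comp_comparison, pairing_comp_map, ← mapExactFunctor_pull, h,
    ← pairing_comp_map, Category.id_comp]

end

/-- The Serre functor commutes with a linear auto-equivalence. -/
noncomputable def comparisonIso (F : A ⥤ A) [F.IsEquivalence] [F.Additive] [F.Linear k] :
    D.S ⋙ F ≅ F ⋙ D.S :=
  NatIso.ofComponents (fun X => asIso (D.comparison F X)) (fun f => D.comparison_naturality F f)

variable {G : Type s} [Group G] (a : LinearAction k G A)

/-- Tested against all classes: each is the image of some `y` under `F g ∘ F h`, transported along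
`ε`, and by invariance both sides pair with it to the pairing of `𝟙` with `y`. -/
lemma comparison_mul (g h : G) (X : A) :
    (a.ε g h).hom.app (D.S.obj X) ≫ D.comparison (a.F (g * h)) X =
      (a.F g).map (D.comparison (a.F h) X) ≫ D.comparison (a.F g) ((a.F h).obj X) ≫
        D.S.map ((a.ε g h).hom.app X) := by
  refine D.pairing_injective fun x => ?_
  obtain ⟨y, rfl⟩ : ∃ y : Ext X (D.S.obj X) 1, pull ((a.ε g h).inv.app X)
      ((y.mapExactFunctor (a.F h)).mapExactFunctor (a.F g)) = x := by
    obtain ⟨y₁, h₁⟩ := (mapExactFunctor_bijective (a.F g)).2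
      (pull (Y := (a.F g).obj ((a.F h).obj (D.S.obj X))) ((a.ε g h).hom.app X) x)
    obtain ⟨y₂, h₂⟩ := (mapExactFunctor_bijective (a.F h)).2 y₁
    dsimp only at h₁ h₂
    exact ⟨y₂, by rw [h₂, h₁]; exact pull_inv_hom ((a.ε g h).app X) _⟩
  have e := push_app_mapExactFunctor (a.ε g h).hom y
  rw [mapExactFunctor_comp_functor] at e
  have e₁ := D.pairing_map_comp_comparison (a.F (g * h)) (𝟙 _) y
  have e₂ := D.pairing_map_comp_comparison (a.F h) (𝟙 _) y
  rw [CategoryTheory.Functor.map_id, Category.id_comp] at e₁ e₂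
  rw [pairing_comp, push_pull, ← Category.assoc, pairing_comp_map]
  erw [e, pull_inv_hom ((a.ε g h).app X), pull_hom_inv ((a.ε g h).app X)]
  rw [e₁, pairing_map_comp_comparison, e₂]

/-- The equivariant structure of the Serre functor. -/
noncomputable def equivariantStructure : EquivariantStructure a D.S where
  -- `comparison` goes from `F g ∘ S` to `S ∘ F g`, against the direction of `τ`.
  τ g := (D.comparisonIso (a.F g)).symm
  coherence g h X := by
    have e := D.comparison_mul a g h X
    have e₁ (g : G) (X : A) : D.comparison (a.F g) X = ((D.comparisonIso (a.F g)).app X).hom := rfl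
    rw [e₁, e₁, e₁] at e
    change D.S.map _ ≫ ((D.comparisonIso (a.F (g * h))).app X).inv =
      ((D.comparisonIso (a.F g)).app _).inv ≫
        (a.F g).map ((D.comparisonIso (a.F h)).app X).inv ≫ _
    rw [Iso.comp_inv_eq, Category.assoc, Category.assoc, e, ← Functor.map_comp_assoc,
      Iso.inv_hom_id, CategoryTheory.Functor.map_id]
    simp

end SerreDuality

end Pairing

end

section

open Abelian

variable {k : Type t} [Field k] {G : Type s} [Group G]
  {A : Type u} [Category.{v} A] [Abelian A] [Linear k A] (a : LinearAction k G A)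

namespace EquivariantObject

instance : PreservesFiniteLimits (forget a) where
  preservesFiniteLimits _ := inferInstance

instance : PreservesFiniteColimits (forget a) where
  preservesFiniteColimits _ := inferInstance

instance : (forget a).Linear k where

/-- The structure maps of equivariant objects, as a natural isomorphism. -/
def forgetIso (g : G) : forget a ≅ forget a ⋙ a.F g :=
  NatIso.ofComponents (fun M => M.α g) (fun f => f.comm g)

end EquivariantObject

open EquivariantObject

attribute [local instance] Abelian.hasFiniteBiproducts

/-! ### The induction functor and its maps to and from the identity. -/

section Induction

variable [Finite G]

/-- The sum of the objects `F g E`. -/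
noncomputable abbrev orbitSum (E : A) : A := ⨁ fun h : G => (a.F h).obj E

/-- The action of a morphism on the sums of the objects `F g E`. -/
noncomputable abbrev orbitMap {E E' : A} (f : E ⟶ E') : orbitSum a E ⟶ orbitSum a E' :=
  biproduct.map fun h => (a.F h).map f

lemma π_eqToHom {j j' : G} (e : j = j') (E : A) :
    biproduct.π (fun h : G => (a.F h).obj E) j ≫ eqToHom (congrArg (fun x => (a.F x).obj E) e) =
      biproduct.π (fun h : G => (a.F h).obj E) j' := by
  subst e
  simp

-- An additive functor preserves the biproduct, so the images of the projections stay jointly monic.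
variable {a} in
lemma map_orbitSum_hom_ext {F : A ⥤ A} [F.Additive] {E Z : A}
    {p q : Z ⟶ F.obj (orbitSum a E)}
    (h : ∀ g, p ≫ F.map (biproduct.π (fun h : G => (a.F h).obj E) g) =
      q ≫ F.map (biproduct.π (fun h : G => (a.F h).obj E) g)) : p = q := by
  have := Fintype.ofFinite G
  have e₁ : 𝟙 _ = F.map (𝟙 (orbitSum a E)) := (F.map_id _).symm
  have e₂ : 𝟙 (orbitSum a E) = ∑ h, biproduct.π (fun h : G => (a.F h).obj E) h ≫
    biproduct.ι (fun h : G => (a.F h).obj E) h :=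
    (IsBilimit.total (biproduct.isBilimit _)).symm
  rw [← Category.comp_id p, ← Category.comp_id q, e₁, e₂, F.map_sum]
  simp only [F.map_comp, Preadditive.comp_sum, ← Category.assoc, h]

section

variable (g : G) (E : A)

/-- The structure map of an induced object. -/
noncomputable def indHom : orbitSum a E ⟶ (a.F g).obj (orbitSum a E) :=
  letI := Fintype.ofFinite G
  ∑ h, biproduct.π _ (g * h) ≫ (a.ε g h).inv.app E ≫
    (a.F g).map (biproduct.ι (fun h : G => (a.F h).obj E) h)

/-- The inverse of the structure map of an induced object. -/
noncomputable def indInv : (a.F g).obj (orbitSum a E) ⟶ orbitSum a E :=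
  letI := Fintype.ofFinite G
  ∑ h, (a.F g).map (biproduct.π (fun h : G => (a.F h).obj E) h) ≫ (a.ε g h).hom.app E ≫
    biproduct.ι (fun h : G => (a.F h).obj E) (g * h)

lemma indHom_map_π (h : G) :
    indHom a g E ≫ (a.F g).map (biproduct.π (fun h : G => (a.F h).obj E) h) =
      biproduct.π _ (g * h) ≫ (a.ε g h).inv.app E := by
  have := Fintype.ofFinite G
  rw [indHom, Preadditive.sum_comp, Finset.sum_eq_single h]
  · simp only [Category.assoc]
    rw [← Functor.map_comp, biproduct.ι_π_self, CategoryTheory.Functor.map_id]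
    simp
  · intro j _ hj
    simp only [Category.assoc]
    rw [← Functor.map_comp, biproduct.ι_π_ne _ hj]
    simp
  · simp

lemma indHom_map_π_assoc (h : G) {Z : A} (f : (a.F g).obj ((a.F h).obj E) ⟶ Z) :
    indHom a g E ≫ (a.F g).map (biproduct.π (fun h : G => (a.F h).obj E) h) ≫ f =
      biproduct.π _ (g * h) ≫ (a.ε g h).inv.app E ≫ f := by
  rw [← Category.assoc, indHom_map_π, Category.assoc]

lemma indInv_π (h : G) :
    indInv a g E ≫ biproduct.π _ (g * h) =
      (a.F g).map (biproduct.π (fun h : G => (a.F h).obj E) h) ≫ (a.ε g h).hom.app E := by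
  have := Fintype.ofFinite G
  rw [indInv, Preadditive.sum_comp, Finset.sum_eq_single h]
  · simp only [Category.assoc]
    rw [biproduct.ι_π_self, Category.comp_id]
  · intro j _ hj
    simp only [Category.assoc]
    rw [biproduct.ι_π_ne _ (fun e => hj (mul_left_cancel e))]
    simp
  · simp

lemma indInv_π_assoc (h : G) {Z : A} (f : (a.F (g * h)).obj E ⟶ Z) :
    indInv a g E ≫ biproduct.π _ (g * h) ≫ f =
      (a.F g).map (biproduct.π (fun h : G => (a.F h).obj E) h) ≫ (a.ε g h).hom.app E ≫ f := by
  rw [← Category.assoc, indInv_π, Category.assoc]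

/-- The structure isomorphism of an induced object. -/
@[simps]
noncomputable def indIso : orbitSum a E ≅ (a.F g).obj (orbitSum a E) where
  hom := indHom a g E
  inv := indInv a g E
  hom_inv_id := by
    refine biproduct.hom_ext _ _ fun j => ?_
    obtain ⟨h, rfl⟩ : ∃ h, j = g * h := ⟨g⁻¹ * j, by simp⟩
    rw [Category.assoc, indInv_π, indHom_map_π_assoc, ← NatTrans.comp_app, Iso.inv_hom_id]
    simp
  inv_hom_id := by
    refine map_orbitSum_hom_ext fun h => ?_
    rw [Category.assoc, indHom_map_π, indInv_π_assoc, ← NatTrans.comp_app, Iso.hom_inv_id]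
    simp

end

lemma indHom_mul (g l : G) (E : A) :
    indHom a (g * l) E =
      indHom a g E ≫ (a.F g).map (indHom a l E) ≫ (a.ε g l).hom.app (orbitSum a E) := by
  refine map_orbitSum_hom_ext fun h => ?_
  have e := EquivariantStructure.ε_naturality a g l (biproduct.π (fun h : G => (a.F h).obj E) h)
  rw [indHom_map_π, Category.assoc, Category.assoc, ← e, ← Functor.map_comp_assoc, indHom_map_π,
    Functor.map_comp_assoc, indHom_map_π_assoc]
  have hc := a.cocycle g l h E
  -- The summands indexed by `g * l * h` and `g * (l * h)` agree only propositionally; this brings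
  -- in the `eqToHom` of the cocycle condition.
  rw [← π_eqToHom a (mul_assoc g l h) E, Category.assoc]
  congr 1
  have h₁ : (a.ε (g * l) h).inv.app E ≫ (a.ε (g * l) h).hom.app E = 𝟙 _ :=
    (a.ε (g * l) h).inv_hom_id_app E
  rw [← cancel_mono ((a.ε (g * l) h).hom.app E), h₁,
    ← cancel_mono (eqToHom (congrArg (fun x => (a.F x).obj E) (mul_assoc g l h)))]
  simp only [Category.assoc]
  rw [hc, ← Functor.map_comp_assoc, Iso.inv_hom_id_app]
  simp

/-- The object induced by `E`. -/
@[simps]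
noncomputable def indObj (E : A) : EquivariantObject a where
  X := orbitSum a E
  α g := indIso a g E
  α_mul g h := indHom_mul a g h E

/-- The induction functor. -/
@[simps obj]
noncomputable def ind : A ⥤ EquivariantObject a where
  obj E := indObj a E
  map {E E'} f :=
    { hom := orbitMap a f
      comm := fun g => map_orbitSum_hom_ext fun h => by
        change (orbitMap a f ≫ indHom a g E') ≫ _ = (indHom a g E ≫ (a.F g).map (orbitMap a f)) ≫ _
        rw [Category.assoc, Category.assoc, indHom_map_π, ← Functor.map_comp, biproduct.map_π,
          Functor.map_comp, indHom_map_π_assoc, biproduct.map_π_assoc]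
        have := (a.ε g h).inv.naturality f
        dsimp at this
        rw [this] }
  map_id E := by
    ext : 1
    change orbitMap a (𝟙 E) = 𝟙 (orbitSum a E)
    refine biproduct.hom_ext _ _ fun j => ?_
    simp
  map_comp f f' := by
    ext : 1
    change orbitMap a (f ≫ f') = orbitMap a f ≫ orbitMap a f'
    refine biproduct.hom_ext _ _ fun j => ?_
    simp

instance : (ind a).Additive where
  map_add {E E' f f'} := by
    ext : 1
    change orbitMap a (f + f') = orbitMap a f + orbitMap a f'
    refine biproduct.hom_ext _ _ fun j => ?_
    simp [Functor.map_add]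

instance : (ind a).Linear k where
  map_smul {E E'} f c := by
    ext : 1
    change orbitMap a (c • f) = c • orbitMap a f
    refine biproduct.hom_ext _ _ fun j => ?_
    simp [Functor.map_smul]

lemma exists_comp_orbitMap_eq {S : ShortComplex A} (hS : S.ShortExact) {T : A}
    (x : T ⟶ orbitSum a S.X₂) (hx : x ≫ orbitMap a S.g = 0) :
    ∃ y : T ⟶ orbitSum a S.X₁, y ≫ orbitMap a S.f = x := by
  have hF (h : G) : (S.map (a.F h)).ShortExact := hS.map_of_exact (a.F h)
  have hm (h : G) : Mono (S.map (a.F h)).f := (hF h).mono_f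
  have hxh (h : G) : (x ≫ biproduct.π (fun h : G => (a.F h).obj S.X₂) h) ≫
      (S.map (a.F h)).g = 0 := by
    change _ ≫ (a.F h).map S.g = 0
    rw [Category.assoc, ← biproduct.map_π (fun h => (a.F h).map S.g), reassoc_of% hx, zero_comp]
  choose y hy using fun h => (⟨_, (hF h).exact.lift_f _ (hxh h)⟩ :
    ∃ y : T ⟶ (a.F h).obj S.X₁, y ≫ (a.F h).map S.f = x ≫ biproduct.π _ h)
  refine ⟨biproduct.lift y, biproduct.hom_ext _ _ fun h => ?_⟩
  rw [Category.assoc, biproduct.map_π, biproduct.lift_π_assoc, hy]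

/-- The faithful exact functor `forget` reflects exactness, and on underlying objects the sequence
is a biproduct of its images under the exact `F h`. -/
lemma shortExact_map_ind (S : ShortComplex A) (hS : S.ShortExact) :
    (S.map (ind a)).ShortExact := by
  have hF (h : G) : (S.map (a.F h)).ShortExact := hS.map_of_exact (a.F h)
  have hm (h : G) : Mono ((a.F h).map S.f) := (hF h).mono_f
  have he (h : G) : Epi ((a.F h).map S.g) := (hF h).epi_g
  have hm' : Mono ((forget a).map ((ind a).map S.f)) := inferInstanceAs (Mono (orbitMap a S.f))
  have he' : Epi ((forget a).map ((ind a).map S.g)) := inferInstanceAs (Epi (orbitMap a S.g))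
  have hm'' : Mono ((S.map (ind a)).map (forget a)).f := hm'
  have hex : ((S.map (ind a)).map (forget a)).Exact :=
    ShortComplex.exact_of_f_is_kernel _ (KernelFork.IsLimit.ofι' _ _ fun x hx =>
      ⟨_, (exists_comp_orbitMap_eq a hS x hx).choose_spec⟩)
  exact
    { exact := (ShortComplex.exact_map_iff_of_faithful _ (forget a)).1 hex
      mono_f := (forget a).mono_of_mono_map hm'
      epi_g := (forget a).epi_of_epi_map he' }

lemma preserves_ind : PreservesFiniteLimits (ind a) ∧ PreservesFiniteColimits (ind a) :=
  ((ind a).exact_tfae.out 0 3).1 (shortExact_map_ind a)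

instance : PreservesFiniteLimits (ind a) := (preserves_ind a).1

instance : PreservesFiniteColimits (ind a) := (preserves_ind a).2

/-- The projections from an induced object. -/
noncomputable def indπ (g : G) : ind a ⋙ forget a ⟶ a.F g where
  app E := biproduct.π (fun h : G => (a.F h).obj E) g
  naturality _ _ f := biproduct.map_π (fun h => (a.F h).map f) g

/-- The canonical morphism from an equivariant object to the induced object. -/
noncomputable def toIndApp (M : EquivariantObject a) : M ⟶ (ind a).obj M.X :=
  { hom := biproduct.lift fun h => (M.α h).hom
    comm := fun g => map_orbitSum_hom_ext fun h => by
      change (biproduct.lift _ ≫ indHom a g M.X) ≫ _ = ((M.α g).hom ≫ (a.F g).map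
        (biproduct.lift (fun h => (M.α h).hom : ∀ h, M.X ⟶ (a.F h).obj M.X))) ≫ _
      rw [Category.assoc, Category.assoc, indHom_map_π, ← Functor.map_comp, biproduct.lift_π,
        biproduct.lift_π_assoc, M.α_mul, Category.assoc, Category.assoc, Iso.hom_inv_id_app]
      simp }

/-- The canonical morphism to the induced object, as a natural transformation. -/
noncomputable def toInd : 𝟭 (EquivariantObject a) ⟶ forget a ⋙ ind a where
  app M := toIndApp a M
  naturality M N f := by
    ext : 1
    change f.hom ≫ biproduct.lift (fun h => (N.α h).hom : ∀ h, N.X ⟶ (a.F h).obj N.X) =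
      biproduct.lift (fun h => (M.α h).hom : ∀ h, M.X ⟶ (a.F h).obj M.X) ≫ orbitMap a f.hom
    refine biproduct.hom_ext _ _ fun h => ?_
    simp [f.comm]

lemma toInd_π (M : EquivariantObject a) (h : G) :
    (toIndApp a M).hom ≫ (indπ a h).app M.X = (M.α h).hom :=
  biproduct.lift_π _ h

/-- The underlying morphism of the canonical morphism to an equivariant object. -/
noncomputable def ofIndHom (M : EquivariantObject a) : orbitSum a M.X ⟶ M.X :=
  letI := Fintype.ofFinite G
  ∑ h, biproduct.π (fun h : G => (a.F h).obj M.X) h ≫ (M.α h).inv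

lemma ofIndHom_eq_sum [Fintype G] (M : EquivariantObject a) : ofIndHom a M =
    ∑ h, biproduct.π (fun h : G => (a.F h).obj M.X) h ≫ (M.α h).inv := by
  rw [ofIndHom]
  congr!

lemma ofIndHom_comm (M : EquivariantObject a) (g : G) :
    ofIndHom a M ≫ (M.α g).hom = indHom a g M.X ≫ (a.F g).map (ofIndHom a M) := by
  have := Fintype.ofFinite G
  rw [ofIndHom_eq_sum, Functor.map_sum, Preadditive.comp_sum, Preadditive.sum_comp,
    ← Equiv.sum_comp (Equiv.mulLeft g)
      (fun h => (biproduct.π (fun h : G => (a.F h).obj M.X) h ≫ (M.α h).inv) ≫ (M.α g).hom)]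
  refine Finset.sum_congr rfl fun h _ => ?_
  rw [Functor.map_comp, indHom_map_π_assoc, Category.assoc]
  congr 1
  change (M.α (g * h)).inv ≫ _ = _
  have h₁ : (a.ε g h).inv.app M.X ≫ (a.ε g h).hom.app M.X = 𝟙 _ :=
    (a.ε g h).inv_hom_id_app M.X
  rw [Iso.inv_comp_eq, M.α_mul]
  simp [← Functor.map_comp]

/-- The canonical morphism from the induced object to an equivariant object. -/
noncomputable def ofInd (M : EquivariantObject a) : (ind a).obj M.X ⟶ M where
  hom := ofIndHom a M
  comm := ofIndHom_comm a M

/-- Each summand contributes `α h` followed by its inverse. -/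
lemma toInd_ofInd (M : EquivariantObject a) :
    toIndApp a M ≫ ofInd a M = Nat.card G • 𝟙 M := by
  have := Fintype.ofFinite G
  ext : 1
  change biproduct.lift (fun h => (M.α h).hom) ≫ ofIndHom a M = Nat.card G • 𝟙 M.X
  rw [ofIndHom_eq_sum, Preadditive.comp_sum]
  simp

end Induction

/-! ### Restriction and transfer on `Ext¹`. -/

section Transfer

universe w'

variable {a} [HasExt.{w} A] [HasExt.{w'} (EquivariantObject a)]
variable {M N : EquivariantObject a}

/-- The action of `g` on the extensions of the underlying objects. -/
noncomputable def act (g : G) (x : Ext M.X N.X 1) : Ext M.X N.X 1 :=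
  push (N.α g).inv (pull (M.α g).hom (x.mapExactFunctor (a.F g)))

/-- The restriction of extensions along the forgetful functor. -/
noncomputable def res (M N : EquivariantObject a) : Ext M N 1 →ₗ[k] Ext M.X N.X 1 :=
  (forget a).mapExtLinearMap k M N 1

/-- The `α g` form a natural isomorphism `forget ≅ forget ⋙ F g`, along which `Ext¹` is natural; so
restricted classes are invariant. -/
lemma act_res (g : G) (z : Ext M N 1) : act g (res M N z) = res M N z := by
  have e := push_app_mapExactFunctor (forgetIso a g).hom z
  rw [mapExactFunctor_comp_functor] at e
  change push (N.α g).hom (res M N z) = pull (M.α g).hom _ at e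
  rw [act]
  exact (congrArg _ e.symm).trans (push_inv_hom _ _)

lemma res_pull {M' : EquivariantObject a} (f : M' ⟶ M) (z : Ext M N 1) :
    res M' N (pull f z) = pull f.hom (res M N z) :=
  mapExactFunctor_pull (forget a) f z

lemma res_push {N' : EquivariantObject a} (f : N ⟶ N') (z : Ext M N 1) :
    res M N' (push f z) = push f.hom (res M N z) :=
  mapExactFunctor_push (forget a) f z

variable [Finite G]

/-- The transfer of extensions of the underlying objects. -/
noncomputable def transfer (M N : EquivariantObject a) : Ext M.X N.X 1 →ₗ[k] Ext M N 1 :=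
  (Ext.mk₀ (toIndApp a M)).precompOfLinear k _ (zero_add 1) ∘ₗ
    (Ext.mk₀ (ofInd a N)).postcompOfLinear k _ (add_zero 1) ∘ₗ
      (ind a).mapExtLinearMap k M.X N.X 1

lemma transfer_apply (x : Ext M.X N.X 1) : transfer M N x =
    pull (toIndApp a M) (push (ofInd a N) (x.mapExactFunctor (ind a))) := rfl

lemma transfer_res (z : Ext M N 1) : transfer M N (res M N z) = Nat.card G • z := by
  have e := push_app_mapExactFunctor (toInd a) z
  rw [mapExactFunctor_id, mapExactFunctor_comp_functor] at e
  rw [transfer_apply, ← push_pull]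
  change push _ (pull _ ((z.mapExactFunctor (forget a)).mapExactFunctor (ind a))) = _
  refine (congrArg (push (Y := (ind a).obj N.X) (ofInd a N)) e.symm).trans ?_
  refine (push_comp (toIndApp a N) (ofInd a N) z).symm.trans ?_
  rw [toInd_ofInd, push_nsmul, push_id]

/-- `ofInd` is a sum over the projections `indπ`, and naturality of `Ext¹` along each projection
replaces the induced class by its image under `F h`. -/
lemma res_transfer [Fintype G] (x : Ext M.X N.X 1) :
    res M N (transfer M N x) = ∑ g, act g x := by
  rw [transfer_apply, res_pull, res_push]
  have e₁ : res _ _ (x.mapExactFunctor (ind a)) = x.mapExactFunctor (ind a ⋙ forget a) :=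
    (mapExactFunctor_comp_functor (ind a) (forget a) x).symm
  have e₂ : (ofInd a N).hom = ∑ h, (indπ a h).app N.X ≫ (N.α h).inv :=
    ofIndHom_eq_sum a N
  have e₃ : push (ofInd a N).hom (res _ _ (x.mapExactFunctor (ind a))) =
      ∑ h, push (N.α h).inv (pull ((indπ a h).app M.X) (x.mapExactFunctor (a.F h))) := by
    rw [e₁, e₂]
    refine (push_sum _ _).trans (Finset.sum_congr rfl fun h _ => ?_)
    exact (push_comp _ _ _).trans (congrArg _ (push_app_mapExactFunctor (indπ a h) x))
  refine (congrArg (pull _) e₃).trans ?_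
  refine (Ext.comp_sum _ _ _).trans ?_
  refine Finset.sum_congr rfl fun h _ => ?_
  refine (push_pull _ _ _).symm.trans (congrArg _ ?_)
  exact (pull_comp _ _ _).symm.trans (by rw [toInd_π])

end Transfer

end

section

open Abelian EquivariantObject

/-! ### Conjugation and averaging of morphisms. -/

section Average

variable {k : Type t} [Field k] {G : Type s} [Group G]
  {A : Type u} [Category.{v} A] [Abelian A] [Linear k A] {a : LinearAction k G A}
  {N P : EquivariantObject a}

namespace EquivariantObject

/-- The conjugate of a morphism by the structure maps of equivariant objects. -/
def conj (N P : EquivariantObject a) (g : G) (u : N.X ⟶ P.X) : N.X ⟶ P.X :=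
  (N.α g).hom ≫ (a.F g).map u ≫ (P.α g).inv

lemma conj_hom (g : G) (f : N ⟶ P) : conj N P g f.hom = f.hom := by
  rw [conj, ← f.comm_assoc, Iso.hom_inv_id, Category.comp_id]

lemma conj_mul (g h : G) (u : N.X ⟶ P.X) :
    conj N P (g * h) u ≫ (P.α g).hom = (N.α g).hom ≫ (a.F g).map (conj N P h u) := by
  have e : (P.α (g * h)).inv ≫ (P.α g).hom =
      (a.ε g h).inv.app P.X ≫ (a.F g).map (P.α h).inv := by
    rw [Iso.inv_comp_eq, P.α_mul]
    simp [← Functor.map_comp]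
  rw [conj, conj, N.α_mul]
  simp only [Category.assoc, e, Functor.map_comp]
  rw [← reassoc_of% (EquivariantStructure.ε_naturality a g h u), Iso.hom_inv_id_app_assoc]

variable [Finite G]

/-- The average of a morphism under conjugation, up to the factor `Nat.card G`. -/
noncomputable def average (N P : EquivariantObject a) (u : N.X ⟶ P.X) : N ⟶ P where
  hom :=
    letI := Fintype.ofFinite G
    ∑ h, conj N P h u
  comm g := by
    let := Fintype.ofFinite G
    rw [Functor.map_sum, Preadditive.comp_sum, Preadditive.sum_comp]
    refine (Equiv.sum_comp (Equiv.mulLeft g)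
      (fun h => conj N P h u ≫ (P.α g).hom)).symm.trans ?_
    exact Finset.sum_congr rfl fun h _ => conj_mul g h u

lemma average_hom [i : Fintype G] (u : N.X ⟶ P.X) :
    (average N P u).hom = ∑ h, conj N P h u := by
  rw [Subsingleton.elim i (Fintype.ofFinite G)]
  rfl

end EquivariantObject

end Average

/-! ### Perfectness of the pairing on equivariant objects, and the conclusion. -/

section EquivariantSerre

universe w'

variable {k : Type t} [Field k] {G : Type s} [Group G]
  {A : Type u} [Category.{v} A] [Abelian A] [Linear k A] [HomFinite k A]
  {a : LinearAction k G A} [HasExt.{w} A]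

namespace SerreDuality

variable (D : SerreDuality k A) {M N : EquivariantObject a}

/-- The Serre functor on equivariant objects. -/
noncomputable abbrev equivariantS (a : LinearAction k G A) :
    EquivariantObject a ⥤ EquivariantObject a :=
  (D.equivariantStructure a).lift

/-- The conjugation action on morphisms to a value of the Serre functor. -/
noncomputable def conj (M N : EquivariantObject a) (g : G) (u : N.X ⟶ D.S.obj M.X) :
    N.X ⟶ D.S.obj M.X :=
  EquivariantObject.conj N ((D.equivariantS a).obj M) g u

lemma conj_eq (g : G) (u : N.X ⟶ D.S.obj M.X) : D.conj M N g u =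
    (N.α g).hom ≫ ((a.F g).map u ≫ D.comparison (a.F g) M.X) ≫ D.S.map (M.α g).inv := by
  rw [Category.assoc]
  rfl

/-- The lifted structure map on `S M` is built from `comparison`, so this is the invariance of the
pairing under `F g`; the `α g` cancel. -/
lemma pairing_conj_act (g : G) (u : N.X ⟶ D.S.obj M.X) (x : Ext M.X N.X 1) :
    D.pairing (D.conj M N g u) (act g x) = D.pairing u x := by
  rw [conj_eq, pairing_comp, act, push_hom_inv, pairing_comp_map, pull_inv_hom,
    pairing_map_comp_comparison]

variable [Finite G]

/-- The pairing as a linear map in the morphism. -/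
noncomputable def pairingLinear (X Y : A) : (Y ⟶ D.S.obj X) →ₗ[k] Module.Dual k (Ext X Y 1) :=
  (D.φ X Y).symm.toLinearMap

variable [HasExt.{w'} (EquivariantObject a)]

/-- The pairing between morphisms and extensions of equivariant objects. -/
noncomputable def equivariantPairing (M N : EquivariantObject a) :
    (N ⟶ (D.equivariantS a).obj M) →ₗ[k] Module.Dual k (Ext M N 1) where
  toFun f := D.pairing f.hom ∘ₗ res M N
  map_add' f f' := by
    ext z
    exact LinearMap.congr_fun ((D.φ M.X N.X).symm.map_add f.hom f'.hom) (res M N z)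
  map_smul' c f := by
    ext z
    exact LinearMap.congr_fun ((D.φ M.X N.X).symm.map_smul c f.hom) (res M N z)

omit [Finite G] in
lemma equivariantPairing_apply (f : N ⟶ (D.equivariantS a).obj M) (z : Ext M N 1) :
    D.equivariantPairing M N f z = D.pairing f.hom (res M N z) := rfl

lemma equivariantPairing_bijective (hG : IsUnit (Nat.card G : k)) (M N : EquivariantObject a) :
    Function.Bijective (D.equivariantPairing M N) := by
  have := Fintype.ofFinite G
  constructor
  · refine (injective_iff_map_eq_zero _).2 fun f hf => hom_ext (D.pairing_injective fun x => ?_)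
    have h₁ : D.pairing f.hom (res M N (transfer M N x)) = 0 := LinearMap.congr_fun hf _
    have h₂ (g : G) : D.pairing f.hom (act g x) = D.pairing f.hom x := by
      rw [← D.pairing_conj_act g f.hom x]
      exact LinearMap.congr_fun (congrArg D.pairing (conj_hom g f).symm) _
    rw [res_transfer, map_sum, Finset.sum_congr rfl fun g _ => h₂ g, Finset.sum_const,
      Finset.card_univ, ← Nat.card_eq_fintype_card, nsmul_eq_mul, hG.mul_right_eq_zero] at h₁
    rw [h₁]
    exact (LinearMap.congr_fun ((D.φ M.X N.X).symm.map_zero) x).symm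
  · intro l
    obtain ⟨c, hc⟩ := hG.exists_left_inv
    -- Here `c` is the inverse of `|G|`. It occurs twice because both the unnormalized average and
    -- `transfer ∘ res` contribute a factor `|G|`.
    let u : N.X ⟶ D.S.obj M.X := D.φ _ _ (c • c • (l ∘ₗ transfer M N))
    refine ⟨average N ((D.equivariantS a).obj M) u, LinearMap.ext fun z => ?_⟩
    have h₁ (g : G) : D.pairing (D.conj M N g u) (res M N z) = D.pairing u (res M N z) := by
      rw [← D.pairing_conj_act g u, act_res]
    rw [equivariantPairing_apply]
    have h₂ : D.pairing (∑ g, D.conj M N g u) (res M N z) =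
        ∑ g, D.pairing (D.conj M N g u) (res M N z) := by
      change D.pairingLinear _ _ _ _ = ∑ g, D.pairingLinear _ _ _ _
      rw [map_sum, LinearMap.sum_apply]
    have h₃ : (average N ((D.equivariantS a).obj M) u).hom = ∑ g, D.conj M N g u :=
      average_hom (P := (D.equivariantS a).obj M) u
    refine (LinearMap.congr_fun (congrArg D.pairing h₃) _).trans (h₂.trans ?_)
    rw [Finset.sum_congr rfl fun g _ => h₁ g, Finset.sum_const, Finset.card_univ,
      ← Nat.card_eq_fintype_card, pairing_φ]
    simp only [LinearMap.smul_apply, LinearMap.comp_apply, transfer_res, map_nsmul, smul_eq_mul,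
      nsmul_eq_mul]
    linear_combination (c * (Nat.card G : k) + 1) * l z * hc

/-- The Serre duality on the category of equivariant objects. -/
noncomputable def equivariant (hG : IsUnit (Nat.card G : k))
    (hS : (D.equivariantS a).IsEquivalence) : SerreDuality k (EquivariantObject a) where
  S := (D.equivariantStructure a).lift
  isEquivalence := hS
  additive := letI := D.additive; inferInstance
  linear := letI := D.linear; inferInstance
  φ M N := (LinearEquiv.ofBijective _ (D.equivariantPairing_bijective hG M N)).symm
  naturality_left {M M'} f N l := by
    obtain ⟨v, rfl⟩ :=
      (LinearEquiv.ofBijective _ (D.equivariantPairing_bijective hG M N)).surjective l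
    rw [LinearEquiv.symm_apply_eq, LinearEquiv.symm_apply_apply]
    ext z
    change D.pairing v.hom (res M N (pull f z)) = D.pairing (v.hom ≫ D.S.map f.hom) (res M' N z)
    rw [res_pull]
    exact (D.pairing_comp_map f.hom _ _).symm
  naturality_right M {N N'} g l := by
    obtain ⟨v, rfl⟩ :=
      (LinearEquiv.ofBijective _ (D.equivariantPairing_bijective hG M N')).surjective l
    rw [LinearEquiv.symm_apply_eq, LinearEquiv.symm_apply_apply]
    ext z
    change D.pairing v.hom (res M N' (push g z)) = D.pairing (g.hom ≫ v.hom) (res M N z)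
    rw [res_push]
    exact (D.pairing_comp g.hom _ _).symm

end SerreDuality

end EquivariantSerre

end

end Equivariantization

theorem corollary3p11 {k : Type t} [Field k]
    {A : Type u} [Category.{v} A] [Abelian A] [Linear k A] [Equivariantization.HomFinite k A]
    {G : Type s} [Group G] [Finite G] (a : Equivariantization.LinearAction k G A)
    (hA : Equivariantization.HasPeriodicSerreDuality k A)
    (hZ : ∀ g : G, Equivariantization.IsCenterLinear (a.F g))
    (hG : IsUnit (Nat.card G : k)) :
    Equivariantization.HasPeriodicSerreDuality k (Equivariantization.EquivariantObject a) := by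
  let : HasExt.{max u v} A := HasExt.standard A
  let : HasExt.{max (max u v s) v} (Equivariantization.EquivariantObject a) :=
    HasExt.standard _
  obtain ⟨D, hD⟩ := hA
  -- Periodicity is proved first because it also yields that the lifted Serre functor is an
  -- equivalence.
  have hp := (D.equivariantStructure a).isPeriodic_lift hZ hD
  exact ⟨D.equivariant hG hp.isEquivalence, hp⟩
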